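/- **Theorem (the implicit Euler scheme for the heat equation on Sierpiński simplices).** Let $d\ge 1$ and let $P_0,\dots,P_{d-1}\in\mathbb R^{d-1}$ be affinely independent. Put $f_i(X)=\frac12(X+P_{i-1})$ for $1\le i\le d$, $V_0=\{P_0,\dots,P_{d-1}\}$, $V_{m}=\bigcup_i f_i(V_{m-1})$ for $m\ge1$, and let $\mathfrak{SS}=\overline{\bigcup_m V_m}$ be the Sierpiński simplex, the unique nonempty compact set with $\mathfrak{SS}=\bigcup_i f_i(\mathfrak{SS})$; its boundary is $V_0$. Write $X\sim_m Y$ if $X=f_{w_1}\circ\dots\circ f_{w_m}(P_i)$ and $Y=f_{w_1}\circ\dots\circ f_{w_m}(P_j)$ for a word $w\in\{1,\dots,d\}^m$ and some $i\ne j$, and for $X\in V_m\setminus V_0$ set $$\Delta_m v(X)=\sum_{Y\sim_m X}(v(Y)-v(X)),\qquad c_m=\tfrac d2(d+2)^m .$$ A continuous function $v$ on $\mathfrak{SS}$ is in the domain of the Laplacian, with Laplacian the continuous function $\Delta v$ on $\mathfrak{SS}$, if $c_m\Delta_m v(X_m)\to\Delta v(X)$ for all $X\in\mathfrak{SS}$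 and all sequences $X_m\in V_m\setminus V_0$ ($m\ge1$) with $X_m\to X$. Let $\tilde\Delta_m$ be the matrix indexed by $V_m\setminus V_0$ with diagonal entries $c_m\,\#\{Z\in V_m: Z\sim_m X\}$, entries $-c_m$ at pairs $X\sim_m Y$, and all other entries $0$; let $\tilde A=I+h\tilde\Delta_m$. For $h>0$, $m\ge 0$, $N\ge 0$ and a function $g$, the implicit Euler scheme is: for $0\le k<N$ and $X\in V_m\setminus V_0$, $$\frac{u_h^m((k+1)h,X)-u_h^m(kh,X)}h=c_m\,\Delta_m u_h^m((k+1)h,\cdot)(X),$$ with $u_h^m(kh,P_j)=0$ for $0\le k\le N$, and $u^m_h(0,X)=g(X)$ for $X\in V_m\setminus V_0$. Let $U(k)$ be the vector $(u_h^m(kh,X))_{X\in V_m\setminus V_0}$. 1. For all $m\ge0$ and $h>0$, $\tilde A$ is invertible, $\|\tilde A^{-1}\|_\infty\le1$ and $\|\tilde A^{-n}\|_\infty\le 1$ for all $n\ge0$, in the operator norm induced by the sup norm. 2. For all $m\ge 0$, $h>0$, $N\ge 0$ and $g$, the scheme has exactly one solution on $V_m$ for $0\le k\le N$; it satisfies $\tilde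 A\,U(k)=U(k-1)$ for $1\le k\le N$, and the scheme is unconditionally stable in the sup norm: $\|U(k)\|_\infty\le\|U(0)\|_\infty$ for $0\le k\le N$. 3. Let $T>0$, $\alpha\ge0$, and let $u:[0,T]\times\mathfrak{SS}\to\mathbb R$ solve the heat equation: for every $t\in\,]0,T[$, $u(t,\cdot)$ is in the domain of the Laplacian and $\partial_tu(t,X)=\Delta u(t,X)$ for all $X\in\mathfrak{SS}$; $u(t,X)=0$ for $X\in V_0$ and $t\in[0,T[$; and $u(0,\cdot)=g$ on $\mathfrak{SS}$. Suppose that for every $X\in\mathfrak{SS}$ the function $u(\cdot,X)$ is twice differentiable on $[0,T]$, with $|\partial_t^2u|$ bounded on $[0,T]\times\mathfrak{SS}$, and that for every $t\in\,]0,T[$ there is $C(t)$ with $|u(t,X)-u(t,Y)|\le C(t)|X-Y|^\alpha$ for all $X,Y\in\mathfrak{SS}$. For $N\ge1$ and $h=T/N$, let $u_h^m$ be the solution of the scheme, and let $$\|w\|_{2,\infty}=\max_{0\le k\le N}\Big(d^{-m}\sum_{X\in V_m}|w(kh,X)|^2\Big)^{1/2}.$$ Then there is a constant $C$, independent of $m$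 and $N$, such that for all $m\ge0$ and $N\ge1$ $$\|u-u_h^m\|_{2,\infty}\le C\,(h+2^{-m\alpha}),$$ and $\|u-u_h^m\|_{2,\infty}\to0$ as $m\to\infty$ and $N\to\infty$ independently, with no restriction linking $h$ and $m$. -/

import Mathlib

open Filter Topology Set

noncomputable section

namespace SierpinskiHeat

/-- The Euclidean space of dimension `d - 1`. -/
abbrev Space (d : ℕ) : Type := EuclideanSpace ℝ (Fin (d - 1))

/-- The contraction `X ↦ (X + P i) / 2` of ratio `1/2`, with fixed point `P i`. -/
def contraction {d : ℕ} (P : Fin d → Space d) (i : Fin d) (X : Space d) : Space d :=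
  (2⁻¹ : ℝ) • (X + P i)

/-- The composition of the contractions along a word. -/
def wordMap {d : ℕ} (P : Fin d → Space d) : List (Fin d) → Space d → Space d
  | [] => id
  | i :: w => contraction P i ∘ wordMap P w

open scoped Classical in
/-- The vertex sets: `V 0 = {P 0, …, P (d - 1)}` and `V (m + 1)` is the union of the images of
`V m` under the contractions. -/
def vertices {d : ℕ} (P : Fin d → Space d) : ℕ → Finset (Space d)
  | 0 => Finset.univ.image P
  | m + 1 => Finset.univ.biUnion fun i => (vertices P m).image (contraction P i)

open scoped Classical in
/-- The interior vertices `V m \ V 0`. -/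
def interiorVertices {d : ℕ} (P : Fin d → Space d) (m : ℕ) : Finset (Space d) :=
  vertices P m \ vertices P 0

/-- Two distinct points are neighbours at level `m` if they are vertices of a common cell
of order `m`: within a cell, the vertices form a complete graph. -/
def Neighbour {d : ℕ} (P : Fin d → Space d) (m : ℕ) (X Y : Space d) : Prop :=
  ∃ w : List (Fin d), w.length = m ∧
    ∃ i j : Fin d, i ≠ j ∧ X = wordMap P w (P i) ∧ Y = wordMap P w (P j)

/-- The Sierpinski simplex, as the closure of the union of all vertex sets; it is the unique
nonempty compact set that is the union of its images under the contractions
(`simplex_nonempty`, `simplex_isCompact`, `simplex_eq_iUnion`, `simplex_unique`). -/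
def simplex {d : ℕ} (P : Fin d → Space d) : Set (Space d) :=
  closure (⋃ m : ℕ, (vertices P m : Set (Space d)))

theorem mem_vertices_succ {d : ℕ} (P : Fin d → Space d) (m : ℕ) (X : Space d) :
    X ∈ vertices P (m + 1) ↔ ∃ i, ∃ Y ∈ vertices P m, contraction P i Y = X := by
  simp [vertices]

theorem mem_vertices_zero {d : ℕ} (P : Fin d → Space d) (i : Fin d) : P i ∈ vertices P 0 := by
  simp [vertices]

theorem continuous_contraction {d : ℕ} (P : Fin d → Space d) (i : Fin d) :
    Continuous (contraction P i) := by
  unfold contraction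
  fun_prop

theorem dist_contraction {d : ℕ} (P : Fin d → Space d) (i : Fin d) (X Y : Space d) :
    dist (contraction P i X) (contraction P i Y) = 2⁻¹ * dist X Y := by
  unfold contraction
  rw [dist_smul₀, dist_add_right]
  norm_num

theorem contraction_self {d : ℕ} (P : Fin d → Space d) (i : Fin d) :
    contraction P i (P i) = P i := by
  unfold contraction
  rw [← two_smul ℝ (P i), smul_smul]
  norm_num

theorem simplex_nonempty {d : ℕ} (hd : 1 ≤ d) (P : Fin d → Space d) : (simplex P).Nonempty :=
  ⟨P ⟨0, hd⟩, subset_closure (mem_iUnion.2 ⟨0, mem_vertices_zero P _⟩)⟩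

theorem simplex_isCompact {d : ℕ} (P : Fin d → Space d) : IsCompact (simplex P) := by
  have hK : IsCompact (convexHull ℝ (range P)) := (finite_range P).isCompact_convexHull ℝ
  refine hK.of_isClosed_subset isClosed_closure (closure_minimal ?_ hK.isClosed)
  refine iUnion_subset fun m => ?_
  induction m with
  | zero =>
    intro X hX
    simp only [vertices, Finset.coe_image, Finset.coe_univ, image_univ] at hX
    exact subset_convexHull ℝ _ hX
  | succ m ih =>
    intro X hX
    obtain ⟨i, Y, hY, rfl⟩ := (mem_vertices_succ P m X).1 hX
    have h := (convex_convexHull ℝ (range P)) (ih hY)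
      (subset_convexHull ℝ _ (mem_range_self i)) (a := 2⁻¹) (b := 2⁻¹)
      (by norm_num) (by norm_num) (by norm_num)
    rwa [← smul_add] at h

theorem simplex_eq_iUnion {d : ℕ} (P : Fin d → Space d) :
    simplex P = ⋃ i, contraction P i '' simplex P := by
  apply Subset.antisymm
  · refine closure_minimal ?_ (isClosed_iUnion_of_finite fun i =>
      ((simplex_isCompact P).image (continuous_contraction P i)).isClosed)
    refine iUnion_subset fun m X hX => ?_
    cases m with
    | zero =>
      simp only [vertices, Finset.coe_image, Finset.coe_univ, image_univ] at hX
      obtain ⟨i, rfl⟩ := hX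
      exact mem_iUnion.2 ⟨i, P i, subset_closure (mem_iUnion.2 ⟨0, mem_vertices_zero P i⟩),
        contraction_self P i⟩
    | succ m =>
      obtain ⟨i, Y, hY, rfl⟩ := (mem_vertices_succ P m X).1 hX
      exact mem_iUnion.2 ⟨i, Y, subset_closure (mem_iUnion.2 ⟨m, hY⟩), rfl⟩
  · refine iUnion_subset fun i => ?_
    refine (image_closure_subset_closure_image (continuous_contraction P i)).trans
      (closure_mono ?_)
    rintro _ ⟨Y, hY, rfl⟩
    obtain ⟨m, hm⟩ := mem_iUnion.1 hY
    exact mem_iUnion.2 ⟨m + 1, (mem_vertices_succ P m _).2 ⟨i, Y, hm, rfl⟩⟩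

theorem simplex_unique {d : ℕ} (hd : 1 ≤ d) (P : Fin d → Space d) (K : Set (Space d))
    (hK : IsCompact K) (hne : K.Nonempty) (h : K = ⋃ i, contraction P i '' K) :
    K = simplex P := by
  have hmaps : ∀ i, ∀ X ∈ K, contraction P i X ∈ K := fun i X hX => by
    rw [h]; exact mem_iUnion.2 ⟨i, X, hX, rfl⟩
  apply Subset.antisymm
  · obtain ⟨X₀, hX₀, hmax⟩ := hK.exists_isMaxOn hne
      (Metric.continuous_infDist_pt (simplex P)).continuousOn
    have hle : Metric.infDist X₀ (simplex P) ≤ 2⁻¹ * Metric.infDist X₀ (simplex P) := by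
      have hX₀' := hX₀
      rw [h] at hX₀'
      obtain ⟨i, Y, hY, hYX⟩ := mem_iUnion.1 hX₀'
      obtain ⟨Z, hZ, hYZ⟩ := (simplex_isCompact P).exists_infDist_eq_dist
        (simplex_nonempty hd P) Y
      have hZ' : contraction P i Z ∈ simplex P := by
        rw [simplex_eq_iUnion P]; exact mem_iUnion.2 ⟨i, Z, hZ, rfl⟩
      have h1 := Metric.infDist_le_dist_of_mem (x := X₀) hZ'
      rw [← hYX, dist_contraction, ← hYZ] at h1
      have h2 : Metric.infDist Y (simplex P) ≤ Metric.infDist X₀ (simplex P) := hmax hY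
      rw [← hYX] at h2 ⊢
      linarith
    intro X hX
    have h0 := Metric.infDist_nonneg (x := X) (s := simplex P)
    have h3 : Metric.infDist X (simplex P) ≤ Metric.infDist X₀ (simplex P) := hmax hX
    have h5 : Metric.infDist X (simplex P) = 0 := by linarith
    exact (isClosed_closure.mem_iff_infDist_zero (simplex_nonempty hd P)).2 h5
  · refine closure_minimal (iUnion_subset fun m => ?_) hK.isClosed
    induction m with
    | zero =>
      intro X hX
      simp only [vertices, Finset.coe_image, Finset.coe_univ, image_univ] at hX
      obtain ⟨i, rfl⟩ := hX
      obtain ⟨Z, hZ, hmin⟩ := hK.exists_isMinOn hne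
        (f := fun Z => dist Z (P i)) (by fun_prop)
      have h1 : dist Z (P i) ≤ dist (contraction P i Z) (P i) := hmin (hmaps i Z hZ)
      have h2 := dist_contraction P i Z (P i)
      rw [contraction_self] at h2
      have h4 := dist_nonneg (x := Z) (y := P i)
      have h3 : dist Z (P i) = 0 := by linarith
      rwa [← dist_eq_zero.1 h3]
    | succ m ih =>
      intro X hX
      obtain ⟨i, Y, hY, rfl⟩ := (mem_vertices_succ P m X).1 hX
      exact hmaps i Y (ih hY)

open scoped Classical in
/-- The graph Laplacian of level `m`: the sum over the neighbours `Y` of `X` of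
`f Y - f X`. -/
def graphLaplacian {d : ℕ} (P : Fin d → Space d) (m : ℕ) (f : Space d → ℝ) (X : Space d) : ℝ :=
  ∑ Y ∈ (vertices P m).filter (fun Y => Neighbour P m X Y), (f Y - f X)

/-- The normalization of the graph Laplacian of level `m`. With `r = d / (d + 2)`, and with
`2 / d * d⁻ᵐ` the integral of the harmonic spline that takes the value 1 at one interior vertex
of level `m` and 0 at the other ones, `r⁻ᵐ` divided by this integral is `d / 2 * (d + 2) ^ m`. -/
def normalization (d m : ℕ) : ℝ := (d : ℝ) / 2 * ((d : ℝ) + 2) ^ m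

/-- `f` is in the domain of the Laplacian of the Sierpinski simplex, and `F` is its Laplacian:
both are continuous, and the normalized graph Laplacians of `f` at `x m` converge to `F X` for
every sequence of interior vertices `x m` of level `m` that converges to `X`. -/
structure HasLaplacian {d : ℕ} (P : Fin d → Space d) (f F : Space d → ℝ) : Prop where
  continuousOn : ContinuousOn f (simplex P)
  continuousOn_laplacian : ContinuousOn F (simplex P)
  tendsto : ∀ X ∈ simplex P, ∀ x : ℕ → Space d,
    (∀ m, 1 ≤ m → x m ∈ interiorVertices P m) → Tendsto x atTop (𝓝 X) →
      Tendsto (fun m => normalization d m * graphLaplacian P m f (x m)) atTop (𝓝 (F X))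

/-- `u` solves the heat equation on the Sierpinski simplex on the time interval `]0, T[`, with
value zero on the boundary `V 0` and initial value `g`. -/
structure IsHeatSolution {d : ℕ} (P : Fin d → Space d) (T : ℝ) (g : Space d → ℝ)
    (u : ℝ → Space d → ℝ) : Prop where
  heat : ∀ t ∈ Ioo 0 T, ∃ F : Space d → ℝ, HasLaplacian P (u t) F ∧
    ∀ X ∈ simplex P, HasDerivAt (fun s => u s X) (F X) t
  boundary : ∀ t ∈ Ico 0 T, ∀ X ∈ vertices P 0, u t X = 0
  initial : ∀ X ∈ simplex P, u 0 X = g X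

/-- On `[0, T]`, `u` is twice differentiable with respect to time, with a second derivative that
is bounded uniformly in time and space. -/
def HasBoundedSecondTimeDeriv {d : ℕ} (P : Fin d → Space d) (T : ℝ)
    (u : ℝ → Space d → ℝ) : Prop :=
  ∃ (u' u'' : ℝ → Space d → ℝ) (M : ℝ), ∀ X ∈ simplex P, ∀ t ∈ Icc 0 T,
    HasDerivWithinAt (fun s => u s X) (u' t X) (Icc 0 T) t ∧
    HasDerivWithinAt (fun s => u' s X) (u'' t X) (Icc 0 T) t ∧
    |u'' t X| ≤ M

/-- `f` is Hölder continuous on the Sierpinski simplex, with exponent `α`. -/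
def IsHolder {d : ℕ} (P : Fin d → Space d) (α : ℝ) (f : Space d → ℝ) : Prop :=
  ∃ C : ℝ, ∀ X ∈ simplex P, ∀ Y ∈ simplex P, |f X - f Y| ≤ C * ‖X - Y‖ ^ α

/-- `U k X`, for `k ≤ N` and `X` in `V m`, satisfies the implicit Euler scheme with time step `h`
and initial data `g`. -/
structure IsImplicitEuler {d : ℕ} (P : Fin d → Space d) (m : ℕ) (h : ℝ) (N : ℕ)
    (g : Space d → ℝ) (U : ℕ → Space d → ℝ) : Prop where
  step : ∀ k < N, ∀ X ∈ interiorVertices P m,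
    (U (k + 1) X - U k X) / h = normalization d m * graphLaplacian P m (U (k + 1)) X
  boundary : ∀ k ≤ N, ∀ X ∈ vertices P 0, U k X = 0
  initial : ∀ X ∈ interiorVertices P m, U 0 X = g X

/-- The vector of the values of `f` at the interior vertices of level `m`. -/
def interiorVector {d : ℕ} (P : Fin d → Space d) (m : ℕ) (f : Space d → ℝ) :
    interiorVertices P m → ℝ := fun X => f X

open scoped Classical in
/-- The normalized Laplacian matrix on `V m \ V 0`: before normalization, the diagonal entry is
the number of neighbours in `V m`, and the entry at a pair of neighbours is `-1`. -/
def laplacianMatrix {d : ℕ} (P : Fin d → Space d) (m : ℕ) :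
    Matrix (interiorVertices P m) (interiorVertices P m) ℝ :=
  Matrix.of fun X Y => normalization d m *
    if X = Y then (((vertices P m).filter (fun Z => Neighbour P m X Z)).card : ℝ)
    else if Neighbour P m X Y then -1 else 0

open scoped Classical in
/-- The matrix `I + h Δ` of the implicit Euler scheme. -/
def eulerMatrix {d : ℕ} (P : Fin d → Space d) (m : ℕ) (h : ℝ) :
    Matrix (interiorVertices P m) (interiorVertices P m) ℝ :=
  1 + h • laplacianMatrix P m

/-- The norm `‖w‖_{2,∞}`, the maximum over `0 ≤ k ≤ N` of the square root of
`d⁻ᵐ * ∑ X ∈ V m, |w k X| ^ 2`. -/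
def normTwoInfty {d : ℕ} (P : Fin d → Space d) (m N : ℕ) (w : ℕ → Space d → ℝ) : ℝ :=
  (Finset.range (N + 1)).sup' Finset.nonempty_range_add_one fun k =>
    √(((d : ℝ) ^ m)⁻¹ * ∑ X ∈ vertices P m, |w k X| ^ 2)

end SierpinskiHeat

end

/- The norm of a matrix is the operator norm induced by the sup norm of vectors. -/
attribute [local instance] Matrix.linftyOpNormedAddCommGroup

namespace SierpinskiHeat

variable {d : ℕ} {P : Fin d → Space d}

/-! Stability is a discrete maximum principle. At a maximum over `V m` the graph Laplacian is
nonpositive, so one implicit step cannot raise the maximum above a nonnegative bound when the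
boundary values are zero (`le_of_eulerStep_le`). Applied to `f` and `-f`, this gives `‖v‖ ≤ ‖A v‖`
for every `h > 0`, hence invertibility of `A`, the bound on its inverse, uniqueness, and propagation
of residuals (`abs_le_of_abs_residual_le`).

Consistency in space rests on summation by parts against harmonic splines: the normalized graph
Laplacian at a vertex is a weighted average of those of the next level at vertices of the two cells
around it. Some vertex nearby therefore has a value at least as large (`exists_normLaplacian_le`).
Iteration gives a convergent sequence of vertices, and its limit `X'` satisfies `normLaplacian P m f
X ≤ F X'` (`HasLaplacian.exists_le`). Two facts follow, with `r = d / (d + 2)`. If `|F| ≤ M` and `f`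
is zero on the boundary, `f` oscillates by at most `M * r ^ m` on cells of order `m`. If `F`
oscillates by at most `B * r ^ m` on these cells, the consistency error is at most `(d + 2) * B * r
^ m`.

For a heat solution, `u s - u t` has Laplacian `u' s - u' t`, bounded by `M * |s - t|` where `M`
bounds the second time derivative. Dividing its oscillation by `|s - t|` and letting `s → t` shows
that `u' t`, which is the Laplacian of `u t`, oscillates by at most `M * r ^ m`. With the
first-order error in time, the total error is `O(h + r ^ m)`, without using the Hölder condition.

If `2 ^ (-α) ≥ r`, this is already the required rate. If `2 ^ (-α) < r`, the Hölder condition is so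
strong that the Laplacian vanishes (`HasLaplacian.nonpos_of_holder`), so `u` and its approximation
are zero on the vertices. -/

/-! ### Cells, addresses of vertices and barycentric coordinates. -/

theorem contraction_injective (P : Fin d → Space d) (i : Fin d) :
    Function.Injective (contraction P i) := by
  intro X Y h
  have h1 := dist_contraction P i X Y
  rw [h, dist_self] at h1
  exact dist_eq_zero.1 (by linarith)

theorem contraction_symm (P : Fin d → Space d) (i j : Fin d) :
    contraction P i (P j) = contraction P j (P i) := by
  simp [contraction, add_comm]

theorem contraction_mem_convexHull {X : Space d} (hX : X ∈ convexHull ℝ (range P)) (i : Fin d) :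
    contraction P i X ∈ convexHull ℝ (range P) := by
  have h := (convex_convexHull ℝ (range P)) hX
    (subset_convexHull ℝ _ (mem_range_self i)) (a := 2⁻¹) (b := 2⁻¹)
    (by norm_num) (by norm_num) (by norm_num)
  rwa [← smul_add] at h

theorem mem_convexHull_self (P : Fin d → Space d) (i : Fin d) : P i ∈ convexHull ℝ (range P) :=
  subset_convexHull ℝ _ (mem_range_self i)

theorem wordMap_mem_convexHull {X : Space d} (hX : X ∈ convexHull ℝ (range P))
    (w : List (Fin d)) : wordMap P w X ∈ convexHull ℝ (range P) := by
  induction w with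
  | nil => exact hX
  | cons a w ih => exact contraction_mem_convexHull ih a

theorem wordMap_injective (P : Fin d → Space d) (w : List (Fin d)) :
    Function.Injective (wordMap P w) := by
  induction w with
  | nil => exact Function.injective_id
  | cons a w ih => exact (contraction_injective P a).comp ih

theorem wordMap_append (P : Fin d → Space d) (v w : List (Fin d)) (X : Space d) :
    wordMap P (v ++ w) X = wordMap P v (wordMap P w X) := by
  induction v with
  | nil => rfl
  | cons a v ih => simp [wordMap, ih]

theorem wordMap_snoc (P : Fin d → Space d) (w : List (Fin d)) (i : Fin d) (X : Space d) :
    wordMap P (w ++ [i]) X = wordMap P w (contraction P i X) := wordMap_append P w [i] X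

theorem dist_wordMap (P : Fin d → Space d) (w : List (Fin d)) (X Y : Space d) :
    dist (wordMap P w X) (wordMap P w Y) = 2⁻¹ ^ w.length * dist X Y := by
  induction w with
  | nil => simp [wordMap]
  | cons a w ih =>
    simp only [wordMap, Function.comp, dist_contraction, ih, List.length_cons, pow_succ]
    ring

theorem mem_vertices_iff (P : Fin d → Space d) (m : ℕ) (X : Space d) :
    X ∈ vertices P m ↔ ∃ w : List (Fin d), w.length = m ∧ ∃ i, wordMap P w (P i) = X := by
  induction m generalizing X with
  | zero => simp [vertices, wordMap]
  | succ m ih =>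
    rw [mem_vertices_succ]
    constructor
    · rintro ⟨a, Y, hY, rfl⟩
      obtain ⟨w, hw, i, rfl⟩ := (ih Y).1 hY
      exact ⟨a :: w, by simp [hw], i, rfl⟩
    · rintro ⟨w, hw, i, rfl⟩
      cases w with
      | nil => simp at hw
      | cons a w => exact ⟨a, _, (ih _).2 ⟨w, by simpa using hw, i, rfl⟩, rfl⟩

theorem wordMap_mem_vertices (P : Fin d → Space d) (w : List (Fin d)) (i : Fin d) :
    wordMap P w (P i) ∈ vertices P w.length :=
  (mem_vertices_iff P _ _).2 ⟨w, rfl, i, rfl⟩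

theorem mem_vertices_zero_iff (P : Fin d → Space d) (X : Space d) :
    X ∈ vertices P 0 ↔ ∃ i, P i = X := by
  simp [vertices]

theorem vertices_subset_simplex (P : Fin d → Space d) (m : ℕ) :
    (vertices P m : Set (Space d)) ⊆ simplex P :=
  fun _ hX => subset_closure (mem_iUnion.2 ⟨m, hX⟩)

theorem wordMap_mem_simplex (P : Fin d → Space d) (w : List (Fin d)) (i : Fin d) :
    wordMap P w (P i) ∈ simplex P :=
  vertices_subset_simplex P _ (wordMap_mem_vertices P w i)

theorem interiorVertices_subset_simplex {m : ℕ} {X : Space d} (hX : X ∈ interiorVertices P m) :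
    X ∈ simplex P :=
  vertices_subset_simplex P m (Finset.mem_sdiff.1 hX).1

theorem mem_interiorVertices_iff {m : ℕ} {X : Space d} :
    X ∈ interiorVertices P m ↔ X ∈ vertices P m ∧ X ∉ vertices P 0 := by
  simp [interiorVertices]

/-- Affinely independent points form an affine basis. -/
theorem exists_affineBasis (hd : 1 ≤ d) (hP : AffineIndependent ℝ P) :
    ∃ b : AffineBasis (Fin d) ℝ (Space d), ⇑b = P := by
  refine ⟨⟨P, hP, ?_⟩, rfl⟩
  rw [hP.affineSpan_eq_top_iff_card_eq_finrank_add_one]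
  simp
  omega

theorem coord_contraction (b : AffineBasis (Fin d) ℝ (Space d)) (hb : ⇑b = P) (i k : Fin d)
    (X : Space d) :
    b.coord k (contraction P i X) = 2⁻¹ * (b.coord k X + if k = i then 1 else 0) := by
  have h : contraction P i X = AffineMap.lineMap X (P i) (2⁻¹ : ℝ) := by
    simp only [contraction, AffineMap.lineMap_apply, vsub_eq_sub, vadd_eq_add]
    module
  rw [h, AffineMap.apply_lineMap, ← hb, AffineBasis.coord_apply, AffineMap.lineMap_apply]
  simp only [vsub_eq_sub, vadd_eq_add, smul_eq_mul]
  ring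

theorem eq_of_coord_eq_one (b : AffineBasis (Fin d) ℝ (Space d)) {X : Space d}
    (hX : ∀ k, 0 ≤ b.coord k X) {i : Fin d} (h : 1 ≤ b.coord i X) : X = b i := by
  have hs := b.sum_coord_apply_eq_one X
  rw [← Finset.add_sum_erase _ _ (Finset.mem_univ i)] at hs
  have h0 : ∑ k ∈ Finset.univ.erase i, b.coord k X = 0 :=
    le_antisymm (by linarith) (Finset.sum_nonneg fun k _ => hX k)
  rw [Finset.sum_eq_zero_iff_of_nonneg fun k _ => hX k] at h0
  refine b.ext_elem fun k => ?_
  rw [AffineBasis.coord_apply]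
  by_cases hk : k = i
  · have h1 : b.coord i X = 1 := by
      rw [Finset.sum_eq_zero (fun j hj => h0 j hj)] at hs
      linarith
    simp [hk, h1]
  · simp [hk, h0 k (by simp [hk])]

theorem coord_le_one (b : AffineBasis (Fin d) ℝ (Space d)) {X : Space d}
    (hX : ∀ k, 0 ≤ b.coord k X) (i : Fin d) : b.coord i X ≤ 1 := by
  rw [← b.sum_coord_apply_eq_one X]
  exact Finset.single_le_sum (f := fun k => b.coord k X) (fun k _ => hX k) (Finset.mem_univ i)

theorem coord_nonneg (b : AffineBasis (Fin d) ℝ (Space d)) (hb : ⇑b = P) {X : Space d}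
    (hX : X ∈ convexHull ℝ (range P)) (k : Fin d) : 0 ≤ b.coord k X := by
  rw [← hb, b.convexHull_eq_nonneg_coord] at hX
  exact hX k

/-- Two different cells of order 1 meet at most in the midpoint of an edge. -/
theorem eq_of_contraction_eq (hd : 1 ≤ d) (hP : AffineIndependent ℝ P) {X Y : Space d}
    (hX : X ∈ convexHull ℝ (range P)) (hY : Y ∈ convexHull ℝ (range P)) {i j : Fin d}
    (hij : i ≠ j) (h : contraction P i X = contraction P j Y) : X = P j ∧ Y = P i := by
  obtain ⟨b, hb⟩ := exists_affineBasis hd hP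
  have hX' := coord_nonneg b hb hX
  have hY' := coord_nonneg b hb hY
  -- Coordinate `i` is at least `1/2` on the cell `i` and at most `1/2` on the cell `j`, and
  -- symmetrically for `j`; a common point must attain both extremes.
  have h1 := congrArg (b.coord i) h
  have h2 := congrArg (b.coord j) h
  simp only [coord_contraction b hb, if_true, if_neg hij, if_neg hij.symm] at h1 h2
  have h3 := coord_le_one b hX' j
  have h4 := coord_le_one b hY' i
  have h5 := hX' i
  have h6 := hY' j
  rw [← hb]
  exact ⟨eq_of_coord_eq_one b hX' (by linarith), eq_of_coord_eq_one b hY' (by linarith)⟩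

theorem eq_of_contraction_eq_vertex (hd : 1 ≤ d) (hP : AffineIndependent ℝ P) {X : Space d}
    (hX : X ∈ convexHull ℝ (range P)) {i c : Fin d} (h : contraction P i X = P c) :
    i = c ∧ X = P c := by
  have hic : i = c := by
    by_contra hic
    rw [← contraction_self P c] at h
    exact hic (hP.injective
      (eq_of_contraction_eq hd hP hX (mem_convexHull_self P c) hic h).2.symm)
  subst hic
  exact ⟨rfl, contraction_injective P i (h.trans (contraction_self P i).symm)⟩

/-- A corner of the simplex lies in only one cell of order `m`. -/
theorem eq_of_wordMap_eq_vertex (hd : 1 ≤ d) (hP : AffineIndependent ℝ P) {X : Space d}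
    (hX : X ∈ convexHull ℝ (range P)) {w : List (Fin d)} {c : Fin d}
    (h : wordMap P w X = P c) : w = List.replicate w.length c ∧ X = P c := by
  induction w with
  | nil => exact ⟨rfl, h⟩
  | cons a w ih =>
    obtain ⟨rfl, h'⟩ := eq_of_contraction_eq_vertex hd hP (wordMap_mem_convexHull hX w) h
    obtain ⟨h1, h2⟩ := ih h'
    refine ⟨?_, h2⟩
    rw [List.length_cons, List.replicate_succ, ← h1]

theorem wordMap_replicate (P : Fin d → Space d) (n : ℕ) (c : Fin d) :
    wordMap P (List.replicate n c) (P c) = P c := by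
  induction n with
  | zero => rfl
  | succ n ih => rw [List.replicate_succ]; simp [wordMap, ih, contraction_self]

/-- Two different cells of the same order have at most one common vertex. -/
theorem eq_of_common_vertices (hd : 1 ≤ d) (hP : AffineIndependent ℝ P) {w w' : List (Fin d)}
    (hl : w.length = w'.length) (hw : w ≠ w') {i i' k k' : Fin d}
    (h : wordMap P w (P i) = wordMap P w' (P i')) (h' : wordMap P w (P k) = wordMap P w' (P k')) :
    i = k := by
  induction w generalizing w' with
  | nil =>
    cases w' with
    | nil => exact absurd rfl hw
    | cons _ _ => simp at hl
  | cons a w ih =>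
    cases w' with
    | nil => simp at hl
    | cons b w' =>
      by_cases hab : a = b
      · subst hab
        exact ih (by simpa using hl) (fun h => hw (by rw [h])) (contraction_injective P a h)
          (contraction_injective P a h')
      · have key : ∀ {j j'}, wordMap P (a :: w) (P j) = wordMap P (b :: w') (P j') →
            wordMap P w (P j) = P b := fun {j j'} h =>
          (eq_of_contraction_eq hd hP (wordMap_mem_convexHull (mem_convexHull_self P _) _)
            (wordMap_mem_convexHull (mem_convexHull_self P _) _) hab h).1
        exact hP.injective (wordMap_injective P w ((key h).trans (key h').symm))

/-- An interior vertex of level `m` is a vertex of exactly two cells of order `m`. -/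
theorem exists_two_addresses (hd : 1 ≤ d) (hP : AffineIndependent ℝ P) (v : List (Fin d))
    (k : Fin d) (hX : wordMap P v (P k) ∉ vertices P 0) :
    ∃ w w' : List (Fin d), ∃ i i' : Fin d, w.length = v.length ∧ w'.length = v.length ∧ w ≠ w' ∧
      wordMap P w (P i) = wordMap P v (P k) ∧ wordMap P w' (P i') = wordMap P v (P k) ∧
      ∀ u j, u.length = v.length → wordMap P u (P j) = wordMap P v (P k) →
        u = w ∧ j = i ∨ u = w' ∧ j = i' := by
  induction v with
  | nil => exact absurd (mem_vertices_zero P k) hX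
  | cons a v ih =>
    have hull : ∀ (u : List (Fin d)) (j : Fin d), wordMap P u (P j) ∈ convexHull ℝ (range P) :=
      fun u j => wordMap_mem_convexHull (mem_convexHull_self P j) u
    -- Either the point is the midpoint of an edge of the whole simplex, with addresses `a b b …`
    -- and `b a a …`, or it is interior to the cell `a` and inherits its two addresses there.
    by_cases hY : wordMap P v (P k) ∈ vertices P 0
    · obtain ⟨b, hb⟩ := (mem_vertices_zero_iff P _).1 hY
      have hX' : wordMap P (a :: v) (P k) = contraction P a (P b) := by
        simp [wordMap, hb]
      rw [hX'] at hX ⊢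
      have hab : a ≠ b := by
        rintro rfl
        rw [contraction_self] at hX
        exact hX (mem_vertices_zero P a)
      refine ⟨a :: List.replicate v.length b, b :: List.replicate v.length a, b, a, by simp,
        by simp, by simp [hab], ?_, ?_, ?_⟩
      · simp [wordMap, wordMap_replicate]
      · simp [wordMap, wordMap_replicate, contraction_symm P b a]
      · rintro (_ | ⟨c, u⟩) j hu h
        · simp at hu
        · have hu' : u.length = v.length := by simpa using hu
          by_cases hca : c = a
          · subst hca
            left
            obtain ⟨h1, h2⟩ := eq_of_wordMap_eq_vertex hd hP (mem_convexHull_self P j)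
              (contraction_injective P c h)
            rw [hu'] at h1
            exact ⟨by rw [← h1], hP.injective h2⟩
          · right
            obtain ⟨h1, h2⟩ := eq_of_contraction_eq hd hP (hull u j) (mem_convexHull_self P b)
              hca h
            obtain ⟨h3, h4⟩ := eq_of_wordMap_eq_vertex hd hP (mem_convexHull_self P j) h1
            rw [hu'] at h3
            rw [← hP.injective h2, ← h3]
            exact ⟨rfl, hP.injective h4⟩
    · obtain ⟨w, w', i, i', hw, hw', hne, hi, hi', hall⟩ := ih hY
      refine ⟨a :: w, a :: w', i, i', by simp [hw], by simp [hw'], by simpa using hne, ?_, ?_, ?_⟩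
      · simp [wordMap, hi]
      · simp [wordMap, hi']
      · rintro (_ | ⟨c, u⟩) j hu h
        · simp at hu
        · have hu' : u.length = v.length := by simpa using hu
          by_cases hca : c = a
          · subst hca
            rcases hall u j hu' (contraction_injective P c h) with ⟨rfl, rfl⟩ | ⟨rfl, rfl⟩
            · exact Or.inl ⟨rfl, rfl⟩
            · exact Or.inr ⟨rfl, rfl⟩
          · have h1 := (eq_of_contraction_eq hd hP (hull u j) (hull v k) hca h).2
            exact absurd (h1 ▸ mem_vertices_zero P c) hY

/-! ### The graph Laplacian as a sum over two cells. -/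

theorem not_neighbour_self (hP : AffineIndependent ℝ P) (m : ℕ) (X : Space d) :
    ¬ Neighbour P m X X := by
  rintro ⟨w, -, i, j, hij, h1, h2⟩
  exact hij (hP.injective (wordMap_injective P w (h1.symm.trans h2)))

/-- The graph Laplacian at a vertex that belongs to two cells. -/
theorem graphLaplacian_eq (hd : 1 ≤ d) (hP : AffineIndependent ℝ P) {m : ℕ} {X : Space d}
    (hX : X ∉ vertices P 0) {w w' : List (Fin d)} {i i' : Fin d} (hw : w.length = m)
    (hw' : w'.length = m) (hne : w ≠ w') (hi : wordMap P w (P i) = X)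
    (hi' : wordMap P w' (P i') = X) (f : Space d → ℝ) :
    graphLaplacian P m f X =
      ∑ k, (f (wordMap P w (P k)) - f X) + ∑ k, (f (wordMap P w' (P k)) - f X) := by
  classical
  -- There are only two addresses, so any two distinct ones are all of them.
  have hall : ∀ u j, u.length = m → wordMap P u (P j) = X → u = w ∧ j = i ∨ u = w' ∧ j = i' := by
    subst hw
    subst hi
    obtain ⟨v, v', j, j', -, -, -, hj, hj', h⟩ := exists_two_addresses hd hP w i hX
    intro u l hu hl
    rcases h w i rfl rfl with ⟨rfl, rfl⟩ | ⟨rfl, rfl⟩ <;>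
      rcases h w' i' hw' hi' with ⟨h1, h2⟩ | ⟨h1, h2⟩
    · exact absurd h1.symm hne
    · rw [h1, h2]; exact h u l hu hl
    · rw [h1, h2]; exact (h u l hu hl).symm
    · exact absurd h1.symm hne
  have hinj : ∀ u : List (Fin d), Function.Injective fun k => wordMap P u (P k) :=
    fun u => (wordMap_injective P u).comp hP.injective
  have hset : (vertices P m).filter (fun Y => Neighbour P m X Y) =
      (Finset.univ.erase i).image (fun k => wordMap P w (P k)) ∪
        (Finset.univ.erase i').image (fun k => wordMap P w' (P k)) := by
    ext Y
    simp only [Finset.mem_filter, Finset.mem_union, Finset.mem_image, Finset.mem_erase,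
      Finset.mem_univ, and_true]
    constructor
    · rintro ⟨-, u, hu, k, l, hkl, h1, h2⟩
      rcases hall u k hu h1.symm with ⟨rfl, rfl⟩ | ⟨rfl, rfl⟩
      · exact Or.inl ⟨l, hkl.symm, h2.symm⟩
      · exact Or.inr ⟨l, hkl.symm, h2.symm⟩
    · rintro (⟨k, hk, rfl⟩ | ⟨k, hk, rfl⟩)
      · exact ⟨hw ▸ wordMap_mem_vertices P w k, w, hw, i, k, hk.symm, hi.symm, rfl⟩
      · exact ⟨hw' ▸ wordMap_mem_vertices P w' k, w', hw', i', k, hk.symm, hi'.symm, rfl⟩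
  have hdisj : Disjoint ((Finset.univ.erase i).image (fun k => wordMap P w (P k)))
      ((Finset.univ.erase i').image (fun k => wordMap P w' (P k))) := by
    rw [Finset.disjoint_left]
    simp only [Finset.mem_image, Finset.mem_erase, Finset.mem_univ, and_true]
    rintro Y ⟨k, hk, rfl⟩ ⟨k', hk', h⟩
    exact hk (eq_of_common_vertices hd hP (hw.trans hw'.symm) hne (hi.trans hi'.symm) h.symm).symm
  have hsum : ∀ (u : List (Fin d)) (j : Fin d), wordMap P u (P j) = X →
      ∑ Y ∈ (Finset.univ.erase j).image (fun k => wordMap P u (P k)), (f Y - f X) =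
        ∑ k, (f (wordMap P u (P k)) - f X) := by
    intro u j hj
    rw [Finset.sum_image fun x _ y _ h => hinj u h]
    exact Finset.sum_erase _ (by rw [hj, sub_self])
  have hdef : graphLaplacian P m f X =
      ∑ Y ∈ (vertices P m).filter (fun Y => Neighbour P m X Y), (f Y - f X) := by
    unfold graphLaplacian
    congr!
  rw [hdef, hset, Finset.sum_union hdisj, hsum w i hi, hsum w' i' hi']

/-- The midpoints of the edges of a cell are not corners of the simplex. -/
theorem wordMap_contraction_notMem (hd : 1 ≤ d) (hP : AffineIndependent ℝ P) (w : List (Fin d))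
    {i j : Fin d} (hij : i ≠ j) : wordMap P w (contraction P i (P j)) ∉ vertices P 0 := by
  intro h
  obtain ⟨c, hc⟩ := (mem_vertices_zero_iff P _).1 h
  have h1 := (eq_of_wordMap_eq_vertex hd hP
    (contraction_mem_convexHull (mem_convexHull_self P j) i) hc.symm).2
  obtain ⟨rfl, h2⟩ := eq_of_contraction_eq_vertex hd hP (mem_convexHull_self P j) h1
  exact hij (hP.injective h2).symm

theorem wordMap_contraction_mem_vertices (P : Fin d → Space d) (w : List (Fin d)) (i j : Fin d) :
    wordMap P w (contraction P i (P j)) ∈ vertices P (w.length + 1) := by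
  rw [← wordMap_snoc]
  simpa using wordMap_mem_vertices P (w ++ [i]) j

theorem vertices_subset_succ (P : Fin d → Space d) (m : ℕ) : vertices P m ⊆ vertices P (m + 1) := by
  intro X hX
  obtain ⟨w, rfl, i, rfl⟩ := (mem_vertices_iff P _ _).1 hX
  simpa [contraction_self] using wordMap_contraction_mem_vertices P w i i

/-! ### One subdivision of a cell and harmonic splines. -/

/-- The weights of the harmonic extension of the indicator of the corner `i` of a cell, at the
midpoint of the edge from `j` to `k`, up to the factor `d + 2`. -/
def splineWeight (i j k : Fin d) : ℝ :=
  if j = k then 0 else 1 + (if j = i then 1 else 0) + (if k = i then 1 else 0)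

theorem splineWeight_nonneg (i j k : Fin d) : 0 ≤ splineWeight i j k := by
  unfold splineWeight
  split_ifs <;> norm_num

theorem splineWeight_self (i j : Fin d) : splineWeight i j j = 0 := by simp [splineWeight]

theorem splineWeight_pos (i : Fin d) {j k : Fin d} (h : j ≠ k) : 0 < splineWeight i j k := by
  unfold splineWeight
  rw [if_neg h]
  split_ifs <;> norm_num

theorem splineWeight_mul_eq (i j k : Fin d) (x : ℝ) :
    splineWeight i j k * x = x + (if j = i then x else 0) + (if k = i then x else 0) -
      (if j = k then (x + (if j = i then x else 0) + (if k = i then x else 0)) else 0) := by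
  unfold splineWeight
  split_ifs <;> ring

theorem sum_sum_splineWeight_mul (i : Fin d) (L : Fin d → Fin d → ℝ) :
    ∑ j, ∑ k, splineWeight i j k * L j k =
      ∑ j, ∑ k, L j k + ∑ k, L i k + ∑ j, L j i - ∑ j, L j j - 2 * L i i := by
  simp only [splineWeight_mul_eq, Finset.sum_sub_distrib, Finset.sum_add_distrib,
    Finset.sum_ite_eq, Finset.sum_ite_eq', Finset.mem_univ, if_true, Finset.sum_ite_irrel,
    Finset.sum_const_zero]
  ring

theorem sum_splineWeight (i : Fin d) :
    ∑ j, ∑ k, splineWeight i j k = ((d : ℝ) - 1) * (d + 2) := by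
  have h := sum_sum_splineWeight_mul i fun _ _ => 1
  simp only [mul_one, Finset.sum_const, Finset.card_univ, Fintype.card_fin, nsmul_eq_mul] at h
  rw [h]
  ring

/-- The graph Laplacian at the midpoint of an edge, in terms of the values `q` on the
subdivision of a cell. -/
def edgeLaplacian (q : Fin d → Fin d → ℝ) (j k : Fin d) : ℝ :=
  ∑ l, (q j l - q j k) + ∑ l, (q k l - q j k)

theorem edgeLaplacian_eq (q : Fin d → Fin d → ℝ) (j k : Fin d) :
    edgeLaplacian q j k = ∑ l, q j l + ∑ l, q k l - 2 * d * q j k := by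
  simp only [edgeLaplacian, Finset.sum_sub_distrib, Finset.sum_const, Finset.card_univ,
    Fintype.card_fin, nsmul_eq_mul]
  ring

/-- Summation by parts, on one cell, against the harmonic extension of the indicator of a
corner. -/
theorem sum_corner_eq (q : Fin d → Fin d → ℝ) (hq : ∀ j k, q j k = q k j) (i : Fin d) :
    d * ∑ k, (q k k - q i i) = (d + 2) * ∑ k, (q i k - q i i) +
      2⁻¹ * ∑ j, ∑ k, splineWeight i j k * edgeLaplacian q j k := by
  rw [sum_sum_splineWeight_mul]
  simp only [edgeLaplacian_eq, Finset.sum_sub_distrib, Finset.sum_add_distrib, Finset.sum_const,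
    Finset.card_univ, Fintype.card_fin, nsmul_eq_mul, ← Finset.mul_sum]
  have h : ∑ j, q j i = ∑ j, q i j := Finset.sum_congr rfl fun j _ => hq j i
  rw [h]
  ring

theorem abs_sum_splineWeight_mul_le {L : Fin d → Fin d → ℝ} {ε : ℝ} (hε : ∀ j k, j ≠ k →
    |L j k| ≤ ε) (i : Fin d) :
    |∑ j, ∑ k, splineWeight i j k * L j k| ≤ ((d : ℝ) - 1) * (d + 2) * ε := by
  rw [← sum_splineWeight i, Finset.sum_mul]
  refine (Finset.abs_sum_le_sum_abs _ _).trans (Finset.sum_le_sum fun j _ => ?_)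
  rw [Finset.sum_mul]
  refine (Finset.abs_sum_le_sum_abs _ _).trans (Finset.sum_le_sum fun k _ => ?_)
  by_cases hjk : j = k
  · simp [hjk, splineWeight_self]
  · rw [abs_mul, abs_of_nonneg (splineWeight_nonneg i j k)]
    exact mul_le_mul_of_nonneg_left (hε j k hjk) (splineWeight_nonneg i j k)

/-- The values at midpoints are close to those of the harmonic extension. -/
theorem abs_sub_harmonic_le (hd : 1 ≤ d) (q : Fin d → Fin d → ℝ) (hq : ∀ j k, q j k = q k j)
    {ε : ℝ} (hε : ∀ j k, j ≠ k → |edgeLaplacian q j k| ≤ ε) {j k : Fin d} (hjk : j ≠ k) :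
    |q j k - (∑ l, q l l + q j j + q k k) / (d + 2)| ≤ ε / 2 := by
  have hd' : (1 : ℝ) ≤ d := by exact_mod_cast hd
  set R := fun i => ∑ j, ∑ k, splineWeight i j k * edgeLaplacian q j k with hR
  -- The corner identity expresses the row sums through the corner values and the residuals;
  -- `edgeLaplacian_eq` can then be solved for `q j k`.
  have hs : ∀ i, ((d : ℝ) + 2) * ∑ k, q i k = d * ∑ l, q l l + 2 * d * q i i - R i / 2 := by
    intro i
    have h := sum_corner_eq q hq i
    simp only [Finset.sum_sub_distrib, Finset.sum_const,
      Finset.card_univ, Fintype.card_fin, nsmul_eq_mul] at h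
    simp only [hR]
    linarith
  have hL := edgeLaplacian_eq q j k
  have key : q j k - (∑ l, q l l + q j j + q k k) / (d + 2) =
      -((R j + R k) / (4 * d * (d + 2)) + edgeLaplacian q j k / (2 * d)) := by
    have h1 : ∑ l, q j l = (d * ∑ l, q l l + 2 * d * q j j - R j / 2) / (d + 2) := by
      rw [← hs]; field_simp
    have h2 : ∑ l, q k l = (d * ∑ l, q l l + 2 * d * q k k - R k / 2) / (d + 2) := by
      rw [← hs]; field_simp
    rw [hL, h1, h2]
    field_simp
    ring
  have hRj := abs_le.1 (abs_sum_splineWeight_mul_le hε j)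
  have hRk := abs_le.1 (abs_sum_splineWeight_mul_le hε k)
  have hLjk := abs_le.1 (hε j k hjk)
  have hb : ε / 2 = (2 * (((d : ℝ) - 1) * (d + 2) * ε)) / (4 * d * (d + 2)) + ε / (2 * d) := by
    field_simp
    ring
  rw [key, abs_neg, hb, abs_le, neg_add, ← neg_div, ← neg_div]
  constructor
  · gcongr
    · linarith [hRj.1, hRk.1]
    · exact hLjk.1
  · gcongr
    · linarith [hRj.2, hRk.2]
    · exact hLjk.2

/-- The oscillation on the cells of the next order. -/
theorem abs_sub_subcell_le (hd : 1 ≤ d) (q : Fin d → Fin d → ℝ) (hq : ∀ j k, q j k = q k j)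
    {ε o : ℝ} (hε0 : 0 ≤ ε) (hε : ∀ j k, j ≠ k → |edgeLaplacian q j k| ≤ ε)
    (ho : ∀ j k, |q j j - q k k| ≤ o) (i j k : Fin d) :
    |q i j - q i k| ≤ d / (d + 2) * o + ε := by
  have hd' : (1 : ℝ) ≤ d := by exact_mod_cast hd
  have ho0 : 0 ≤ o := (abs_nonneg _).trans (ho i i)
  have hcorner : ∀ k, i ≠ k → |q i i - q i k| ≤ d / (d + 2) * o + ε := by
    intro k hik
    have h1 := abs_le.1 (abs_sub_harmonic_le hd q hq hε hik)
    have h2 : |q i i - (∑ l, q l l + q i i + q k k) / (d + 2)| ≤ d / (d + 2) * o := by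
      -- There are `d` differences of corner values in all, each at most `o`; this is the origin of
      -- the factor `d / (d + 2)`.
      have h3 : q i i - (∑ l, q l l + q i i + q k k) / (d + 2) =
          ((q i i - q k k) + ∑ l ∈ Finset.univ.erase i, (q i i - q l l)) / (d + 2) := by
        rw [Finset.sum_erase _ (sub_self _), Finset.sum_sub_distrib, Finset.sum_const,
          Finset.card_univ, Fintype.card_fin, nsmul_eq_mul]
        field_simp
        ring
      rw [h3, abs_div, abs_of_pos (by positivity : (0 : ℝ) < d + 2), div_mul_eq_mul_div]
      gcongr
      refine (abs_add_le _ _).trans ?_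
      have h4 : |∑ l ∈ Finset.univ.erase i, (q i i - q l l)| ≤ ((d : ℝ) - 1) * o := by
        refine (Finset.abs_sum_le_sum_abs _ _).trans ?_
        refine (Finset.sum_le_card_nsmul _ _ o fun l _ => ho i l).trans ?_
        rw [Finset.card_erase_of_mem (Finset.mem_univ i), Finset.card_univ, Fintype.card_fin,
          nsmul_eq_mul, Nat.cast_sub hd, Nat.cast_one]
      linarith [ho i k]
    have h5 := abs_le.1 h2
    rw [abs_le]
    constructor <;> linarith [h1.1, h1.2, h5.1, h5.2]
  by_cases hij : i = j
  · subst hij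
    by_cases hik : i = k
    · subst hik
      rw [sub_self, abs_zero]
      positivity
    · exact hcorner k hik
  · by_cases hik : i = k
    · subst hik
      rw [abs_sub_comm]
      exact hcorner j hij
    · have h1 := abs_le.1 (abs_sub_harmonic_le hd q hq hε hij)
      have h2 := abs_le.1 (abs_sub_harmonic_le hd q hq hε hik)
      have h3 : |(∑ l, q l l + q i i + q j j) / (d + 2) - (∑ l, q l l + q i i + q k k) / (d + 2)|
          ≤ d / (d + 2) * o := by
        rw [← sub_div, abs_div, abs_of_pos (by positivity : (0 : ℝ) < d + 2), div_mul_eq_mul_div]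
        gcongr
        rw [show ∑ l, q l l + q i i + q j j - (∑ l, q l l + q i i + q k k) = q j j - q k k by ring]
        nlinarith [ho j k]
      have h5 := abs_le.1 h3
      rw [abs_le]
      constructor <;> linarith [h1.1, h1.2, h2.1, h2.2, h5.1, h5.2]

/-! ### Passage from one level to the next. -/

/-- The sum of the differences of the values of `f` at the vertices of a cell and at its
corner `i`. -/
noncomputable def cornerSum (P : Fin d → Space d) (f : Space d → ℝ) (w : List (Fin d)) (i : Fin d) : ℝ :=
  ∑ k, (f (wordMap P w (P k)) - f (wordMap P w (P i)))

theorem sum_cornerSum (P : Fin d → Space d) (f : Space d → ℝ) (w : List (Fin d)) :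
    ∑ i, cornerSum P f w i = 0 := by
  simp only [cornerSum, Finset.sum_sub_distrib, Finset.sum_const, Finset.card_univ,
    Fintype.card_fin, nsmul_eq_mul, ← Finset.mul_sum, sub_self]

theorem graphLaplacian_midpoint (hd : 1 ≤ d) (hP : AffineIndependent ℝ P) (f : Space d → ℝ)
    (w : List (Fin d)) {j k : Fin d} (hjk : j ≠ k) :
    graphLaplacian P (w.length + 1) f (wordMap P w (contraction P j (P k))) =
      edgeLaplacian (fun j k => f (wordMap P w (contraction P j (P k)))) j k := by
  rw [graphLaplacian_eq hd hP (wordMap_contraction_notMem hd hP w hjk) (w := w ++ [j])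
    (w' := w ++ [k]) (i := k) (i' := j) (by simp) (by simp) (by simpa using hjk)
    (wordMap_snoc P w j _) (by rw [wordMap_snoc, contraction_symm])]
  simp only [wordMap_snoc, edgeLaplacian]

/-- This transfers `sum_corner_eq` to the fractal. The factor `2⁻¹` appears because the double sum
counts each edge twice; the diagonal terms have weight zero. -/
theorem cornerSum_refine (hd : 1 ≤ d) (hP : AffineIndependent ℝ P) (f : Space d → ℝ)
    (w : List (Fin d)) (i : Fin d) :
    d * cornerSum P f w i = (d + 2) * cornerSum P f (w ++ [i]) i + 2⁻¹ * ∑ j, ∑ k,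
      splineWeight i j k *
        graphLaplacian P (w.length + 1) f (wordMap P w (contraction P j (P k))) := by
  have h := sum_corner_eq (fun j k => f (wordMap P w (contraction P j (P k))))
    (fun j k => by rw [contraction_symm]) i
  simp only [contraction_self] at h
  simp only [cornerSum, wordMap_snoc, contraction_self]
  rw [h]
  congr 2
  refine Finset.sum_congr rfl fun j _ => Finset.sum_congr rfl fun k _ => ?_
  by_cases hjk : j = k
  · simp [hjk, splineWeight_self]
  · rw [graphLaplacian_midpoint hd hP f w hjk]

/-- The normalized graph Laplacian. -/
noncomputable def normLaplacian (P : Fin d → Space d) (m : ℕ) (f : Space d → ℝ) (X : Space d) : ℝ :=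
  normalization d m * graphLaplacian P m f X

theorem normalization_pos (hd : 1 ≤ d) (m : ℕ) : 0 < normalization d m := by
  have hd' : (1 : ℝ) ≤ d := by exact_mod_cast hd
  unfold normalization
  positivity

theorem normalization_succ (d m : ℕ) :
    normalization d (m + 1) = (d + 2) * normalization d m := by
  unfold normalization
  ring

/-- The normalized graph Laplacian at `X` is at most a normalized graph Laplacian of the next
level, at a vertex of a cell that contains `X`. -/
theorem exists_normLaplacian_le (hd : 1 ≤ d) (hP : AffineIndependent ℝ P) (f : Space d → ℝ)
    {m : ℕ} {X : Space d} (hX : X ∈ interiorVertices P m) :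
    ∃ (w : List (Fin d)) (i j k : Fin d), w.length = m ∧ wordMap P w (P i) = X ∧
      wordMap P w (contraction P j (P k)) ∈ interiorVertices P (m + 1) ∧
      normLaplacian P m f X ≤
        normLaplacian P (m + 1) f (wordMap P w (contraction P j (P k))) := by
  obtain ⟨hXm, hX0⟩ := mem_interiorVertices_iff.1 hX
  obtain ⟨v, hv, l, rfl⟩ := (mem_vertices_iff P _ _).1 hXm
  obtain ⟨w, w', i, i', hw, hw', hne, hi, hi', -⟩ := exists_two_addresses hd hP v l hX0
  rw [hv] at hw hw'
  set X := wordMap P v (P l)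
  by_contra! hcon
  have hd' : (1 : ℝ) ≤ d := by exact_mod_cast hd
  have hedge : ∀ (u : List (Fin d)) (a : Fin d), u.length = m → wordMap P u (P a) = X →
      ∑ j, ∑ k, splineWeight a j k *
        normLaplacian P (m + 1) f (wordMap P u (contraction P j (P k))) ≤
        ((d : ℝ) - 1) * (d + 2) * normLaplacian P m f X := by
    intro u a hu ha
    rw [← sum_splineWeight a, Finset.sum_mul]
    refine Finset.sum_le_sum fun j _ => ?_
    rw [Finset.sum_mul]
    refine Finset.sum_le_sum fun k _ => ?_
    by_cases hjk : j = k
    · simp [hjk, splineWeight_self]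
    · refine mul_le_mul_of_nonneg_left (hcon u a j k hu ha ?_).le (splineWeight_nonneg a j k)
      exact mem_interiorVertices_iff.2 ⟨hu ▸ wordMap_contraction_mem_vertices P u j k,
        wordMap_contraction_notMem hd hP u hjk⟩
  -- The choice `j = k = i` gives `X` itself. Its weight is positive, so this single strict
  -- inequality suffices for the contradiction.
  have hself : normLaplacian P (m + 1) f X < normLaplacian P m f X := by
    have h := hcon w i i i hw hi
    rw [contraction_self, hi] at h
    exact h (mem_interiorVertices_iff.2 ⟨vertices_subset_succ P m hXm, hX0⟩)
  have hE : ∀ (u : List (Fin d)) (a : Fin d), u.length = m →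
      ∑ j, ∑ k, splineWeight a j k *
        normLaplacian P (m + 1) f (wordMap P u (contraction P j (P k))) =
      normalization d (m + 1) * ∑ j, ∑ k, splineWeight a j k *
        graphLaplacian P (u.length + 1) f (wordMap P u (contraction P j (P k))) := by
    intro u a hu
    simp only [Finset.mul_sum, normLaplacian, hu]
    refine Finset.sum_congr rfl fun j _ => Finset.sum_congr rfl fun k _ => ?_
    ring
  have h1 : graphLaplacian P m f X = cornerSum P f w i + cornerSum P f w' i' := by
    rw [graphLaplacian_eq hd hP hX0 hw hw' hne hi hi', cornerSum, cornerSum, hi, hi']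
  have h2 : graphLaplacian P (m + 1) f X =
      cornerSum P f (w ++ [i]) i + cornerSum P f (w' ++ [i']) i' := by
    have hs : ∀ u (a : Fin d), wordMap P u (P a) = X → wordMap P (u ++ [a]) (P a) = X :=
      fun u a h => by rw [wordMap_snoc, contraction_self, h]
    rw [graphLaplacian_eq hd hP hX0 (w := w ++ [i]) (w' := w' ++ [i']) (by simp [hw])
      (by simp [hw']) ?_ (hs w i hi) (hs w' i' hi'), cornerSum, cornerSum, hs w i hi, hs w' i' hi']
    intro h
    exact hne (List.append_inj_left' h rfl)
  have h3 := hedge w i hw hi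
  have h4 := hedge w' i' hw' hi'
  rw [hE w i hw] at h3
  rw [hE w' i' hw'] at h4
  have h5 := cornerSum_refine hd hP f w i
  have h6 := cornerSum_refine hd hP f w' i'
  set E := ∑ j, ∑ k, splineWeight i j k *
        graphLaplacian P (w.length + 1) f (wordMap P w (contraction P j (P k)))
  set E' := ∑ j, ∑ k, splineWeight i' j k *
        graphLaplacian P (w'.length + 1) f (wordMap P w' (contraction P j (P k)))
  have h7 : d * graphLaplacian P m f X =
      (d + 2) * graphLaplacian P (m + 1) f X + 2⁻¹ * (E + E') := by
    rw [h1, h2]; linarith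
  -- This is the averaging identity: the weights are `d + 2` at `X` and `(d - 1) * (d + 2) / 2` in
  -- total on each of the two cells, with sum `d * (d + 2)`.
  have h8 : d * (d + 2) * normLaplacian P m f X = (d + 2) * normLaplacian P (m + 1) f X +
      2⁻¹ * (normalization d (m + 1) * E + normalization d (m + 1) * E') := by
    simp only [normLaplacian, normalization_succ]
    linear_combination ((d : ℝ) + 2) * normalization d m * h7
  have h9 : ((d : ℝ) + 2) * normLaplacian P (m + 1) f X < (d + 2) * normLaplacian P m f X :=
    mul_lt_mul_of_pos_left hself (by positivity)
  nlinarith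

theorem graphLaplacian_const_mul (P : Fin d → Space d) (m : ℕ) (c : ℝ) (f : Space d → ℝ)
    (X : Space d) : graphLaplacian P m (fun Y => c * f Y) X = c * graphLaplacian P m f X := by
  simp only [graphLaplacian, Finset.mul_sum, mul_sub]

theorem graphLaplacian_sub (P : Fin d → Space d) (m : ℕ) (f g : Space d → ℝ)
    (X : Space d) : graphLaplacian P m (fun Y => f Y - g Y) X =
      graphLaplacian P m f X - graphLaplacian P m g X := by
  simp only [graphLaplacian, ← Finset.sum_sub_distrib]
  exact Finset.sum_congr rfl fun Y _ => by ring

theorem HasLaplacian.const_mul (c : ℝ) (hf : HasLaplacian P f F) :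
    HasLaplacian P (fun X => c * f X) (fun X => c * F X) where
  continuousOn := continuousOn_const.mul hf.continuousOn
  continuousOn_laplacian := continuousOn_const.mul hf.continuousOn_laplacian
  tendsto X hX x hx hxX := by
    simpa only [graphLaplacian_const_mul, mul_left_comm] using
      (hf.tendsto X hX x hx hxX).const_mul c

theorem HasLaplacian.neg (hf : HasLaplacian P f F) :
    HasLaplacian P (fun X => -f X) (fun X => -F X) := by
  simpa using hf.const_mul (-1)

theorem HasLaplacian.sub {g G : Space d → ℝ} (hf : HasLaplacian P f F)
    (hg : HasLaplacian P g G) : HasLaplacian P (fun X => f X - g X) (fun X => F X - G X) where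
  continuousOn := hf.continuousOn.sub hg.continuousOn
  continuousOn_laplacian := hf.continuousOn_laplacian.sub hg.continuousOn_laplacian
  tendsto X hX x hx hxX := by
    simpa only [graphLaplacian_sub, mul_sub] using
      (hf.tendsto X hX x hx hxX).sub (hg.tendsto X hX x hx hxX)

theorem normLaplacian_neg (P : Fin d → Space d) (m : ℕ) (f : Space d → ℝ) (X : Space d) :
    normLaplacian P m (fun Y => -f Y) X = -normLaplacian P m f X := by
  have h := graphLaplacian_const_mul P m (-1) f X
  simp only [neg_mul, one_mul] at h
  rw [normLaplacian, h, normLaplacian, mul_neg]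

/-! ### Comparison of the graph Laplacians with the Laplacian. -/

theorem contraction_mem_simplex {X : Space d} (hX : X ∈ simplex P) (i : Fin d) :
    contraction P i X ∈ simplex P := by
  rw [simplex_eq_iUnion P]
  exact mem_iUnion.2 ⟨i, X, hX, rfl⟩

theorem wordMap_mem_simplex' {X : Space d} (hX : X ∈ simplex P) (w : List (Fin d)) :
    wordMap P w X ∈ simplex P := by
  induction w with
  | nil => exact hX
  | cons a w ih => exact contraction_mem_simplex ih a

theorem vertex_mem_simplex (P : Fin d → Space d) (i : Fin d) : P i ∈ simplex P :=
  wordMap_mem_simplex P [] i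

theorem dist_wordMap_le {X Y : Space d} (hX : X ∈ simplex P) (hY : Y ∈ simplex P)
    (w : List (Fin d)) :
    dist (wordMap P w X) (wordMap P w Y) ≤ Metric.diam (simplex P) / 2 ^ w.length := by
  rw [dist_wordMap, inv_pow, inv_mul_eq_div]
  gcongr
  exact Metric.dist_le_diam_of_mem (simplex_isCompact P).isBounded hX hY

theorem interiorVertices_nonempty (hd : 2 ≤ d) (hP : AffineIndependent ℝ P) {m : ℕ}
    (hm : 1 ≤ m) : (interiorVertices P m).Nonempty := by
  refine ⟨contraction P ⟨0, by omega⟩ (P ⟨1, by omega⟩), mem_interiorVertices_iff.2 ⟨?_,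
    wordMap_contraction_notMem (by omega) hP [] (by simp)⟩⟩
  induction m, hm using Nat.le_induction with
  | base => exact wordMap_contraction_mem_vertices P [] _ _
  | succ m _ ih => exact vertices_subset_succ P m ih

/-- From an interior vertex `X`, a sequence of vertices along which the normalized graph
Laplacian increases, and whose limit stays close to `X`. -/
theorem HasLaplacian.exists_le (hd : 2 ≤ d) (hP : AffineIndependent ℝ P)
    (hf : HasLaplacian P f F) {m : ℕ} {X : Space d} (hX : X ∈ interiorVertices P m) :
    ∃ x : ℕ → Space d, ∃ X' ∈ simplex P, x 0 = X ∧ Tendsto x atTop (𝓝 X') ∧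
      (∀ n, ∃ (w : List (Fin d)) (i j k : Fin d), w.length = m + n ∧ wordMap P w (P i) = x n ∧
        wordMap P w (contraction P j (P k)) = x (n + 1)) ∧
      dist X X' ≤ 2 * Metric.diam (simplex P) / 2 ^ m ∧ normLaplacian P m f X ≤ F X' := by
  have : Nonempty (Fin d) := ⟨⟨0, by omega⟩⟩
  choose! w i j k h using fun (n : ℕ) (Y : Space d) (hY : Y ∈ interiorVertices P n) =>
    exists_normLaplacian_le (by omega) hP f hY
  let x : ℕ → Space d := fun n => Nat.rec X
    (fun n Y => wordMap P (w (m + n) Y) (contraction P (j (m + n) Y) (P (k (m + n) Y)))) n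
  have hx : ∀ n, x n ∈ interiorVertices P (m + n) := by
    intro n
    induction n with
    | zero => exact hX
    | succ n ih => exact (h _ _ ih).2.2.1
  have hmono : ∀ n, normLaplacian P m f X ≤ normLaplacian P (m + n) f (x n) := by
    intro n
    induction n with
    | zero => exact le_rfl
    | succ n ih => exact ih.trans (h _ _ (hx n)).2.2.2
  have hdist : ∀ n, dist (x n) (x (n + 1)) ≤ 2 * Metric.diam (simplex P) / 2 ^ m / 2 / 2 ^ n := by
    intro n
    obtain ⟨h1, h2, -, -⟩ := h _ _ (hx n)
    have h3 := dist_wordMap_le (vertex_mem_simplex P (i (m + n) (x n)))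
      (contraction_mem_simplex (vertex_mem_simplex P (k (m + n) (x n))) (j (m + n) (x n)))
      (w (m + n) (x n))
    rw [h2, h1] at h3
    refine h3.trans_eq ?_
    rw [pow_add]
    field_simp
  obtain ⟨X', hX'⟩ := cauchySeq_tendsto_of_complete (cauchySeq_of_le_geometric_two hdist)
  have hX's : X' ∈ simplex P := isClosed_closure.mem_of_tendsto hX'
    (Eventually.of_forall fun n => interiorVertices_subset_simplex (hx n))
  refine ⟨x, X', hX's, rfl, hX', fun n => ⟨_, _, _, _, (h _ _ (hx n)).1, (h _ _ (hx n)).2.1, rfl⟩,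
    dist_le_of_le_geometric_two_of_tendsto₀ hdist hX', ?_⟩
  -- The definition of the Laplacian tests sequences with an interior vertex at every level from 1
  -- on. Arbitrary ones fill the levels below `m`, where the limit ignores them.
  choose! z hz using fun (n : ℕ) (hn : 1 ≤ n) => interiorVertices_nonempty hd hP hn
  let y : ℕ → Space d := fun n => if n < m then z n else x (n - m)
  have hyx : ∀ n, y (n + m) = x n := fun n => by simp [y]
  have hy : ∀ n, 1 ≤ n → y n ∈ interiorVertices P n := by
    intro n hn
    by_cases hnm : n < m
    · simpa [y, hnm] using hz n hn
    · obtain ⟨l, rfl⟩ := Nat.exists_eq_add_of_le (not_lt.1 hnm)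
      rw [add_comm, hyx, add_comm]
      exact hx l
  have hyX : Tendsto y atTop (𝓝 X') := by
    rw [← tendsto_add_atTop_iff_nat m]
    simpa only [hyx] using hX'
  have hlim := (tendsto_add_atTop_iff_nat m).2 (hf.tendsto X' hX's y hy hyX)
  refine ge_of_tendsto' hlim fun n => ?_
  rw [hyx, add_comm n m]
  exact hmono n

/-- `exists_le` bounds the graph Laplacian by a value of `F`; using it for `f` and `-f` gives both
signs. The bound holds at every level and not only in the limit. -/
theorem HasLaplacian.abs_normLaplacian_le (hd : 2 ≤ d) (hP : AffineIndependent ℝ P)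
    (hf : HasLaplacian P f F) {M : ℝ} (hM : ∀ X ∈ simplex P, |F X| ≤ M) {m : ℕ} {X : Space d}
    (hX : X ∈ interiorVertices P m) : |normLaplacian P m f X| ≤ M := by
  obtain ⟨-, Y, hY, -, -, -, -, h1⟩ := hf.exists_le hd hP hX
  obtain ⟨-, Z, hZ, -, -, -, -, h2⟩ := hf.neg.exists_le hd hP hX
  rw [normLaplacian_neg] at h2
  exact abs_le.2 ⟨by linarith [(abs_le.1 (hM Z hZ)).1], h1.trans ((abs_le.1 (hM Y hY)).2)⟩

/-- A function with bounded Laplacian that vanishes on the boundary is Lipschitz continuous in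
the resistance metric: its oscillation on the cells decreases by the factor `d / (d + 2)`. -/
theorem HasLaplacian.abs_sub_le_pow (hd : 2 ≤ d) (hP : AffineIndependent ℝ P)
    (hf : HasLaplacian P f F) (hf0 : ∀ X ∈ vertices P 0, f X = 0) {M : ℝ}
    (hM : ∀ X ∈ simplex P, |F X| ≤ M) (w : List (Fin d)) (i j : Fin d) :
    |f (wordMap P w (P i)) - f (wordMap P w (P j))| ≤ M * ((d : ℝ) / (d + 2)) ^ w.length := by
  have hd' : (2 : ℝ) ≤ d := by exact_mod_cast hd
  have hM0 : 0 ≤ M := (abs_nonneg _).trans (hM _ (vertex_mem_simplex P i))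
  -- The subtracted term absorbs the errors added at each level. With `s = 1 / (d + 2)`, the
  -- induction closes because `r * (r ^ n - s ^ n) + (d - 1) * s ^ (n + 1) = r ^ (n + 1) - s ^ (n +
  -- 1)`.
  suffices h : ∀ (w : List (Fin d)) (i j : Fin d),
      |f (wordMap P w (P i)) - f (wordMap P w (P j))| ≤
        M * (((d : ℝ) / (d + 2)) ^ w.length - (1 / (d + 2)) ^ w.length) by
    refine (h w i j).trans ?_
    gcongr
    have : (0 : ℝ) ≤ (1 / (d + 2)) ^ w.length := by positivity
    linarith
  intro w
  induction w using List.reverseRecOn with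
  | nil =>
    intro i j
    simp [wordMap, hf0 _ (mem_vertices_zero P i), hf0 _ (mem_vertices_zero P j)]
  | append_singleton w a ih =>
    intro i j
    have hc := normalization_pos (d := d) (by omega) (w.length + 1)
    have hε : ∀ j k, j ≠ k →
        |edgeLaplacian (fun j k => f (wordMap P w (contraction P j (P k)))) j k| ≤
          M / normalization d (w.length + 1) := by
      intro j k hjk
      rw [← graphLaplacian_midpoint (by omega) hP f w hjk, le_div_iff₀' hc, ← abs_of_pos hc,
        ← abs_mul]
      exact hf.abs_normLaplacian_le hd hP hM (mem_interiorVertices_iff.2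
        ⟨wordMap_contraction_mem_vertices P w j k,
          wordMap_contraction_notMem (by omega) hP w hjk⟩)
    have h := abs_sub_subcell_le (by omega)
      (fun j k => f (wordMap P w (contraction P j (P k))))
      (fun j k => by rw [contraction_symm]) (by positivity) hε
      (o := M * (((d : ℝ) / (d + 2)) ^ w.length - (1 / (d + 2)) ^ w.length))
      (fun j k => by simpa only [contraction_self] using ih j k) a i j
    rw [wordMap_snoc, wordMap_snoc]
    refine h.trans ?_
    -- This amounts to `2 / d ≤ d - 1`, which needs `2 ≤ d`.
    have hn : M / normalization d (w.length + 1) ≤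
        M * (((d : ℝ) - 1) * (1 / (d + 2)) ^ (w.length + 1)) := by
      rw [normalization, div_eq_mul_inv]
      gcongr
      rw [mul_inv, one_div, inv_pow]
      gcongr
      rw [inv_div, div_le_iff₀ (by positivity)]
      nlinarith
    refine (add_le_add_right hn _).trans_eq ?_
    simp only [List.length_append, List.length_singleton, pow_succ]
    field_simp
    ring

/-- Consistency: the normalized graph Laplacian approximates the Laplacian up to the oscillation
of the latter. -/
theorem HasLaplacian.abs_normLaplacian_sub_le (hd : 2 ≤ d) (hP : AffineIndependent ℝ P)
    (hf : HasLaplacian P f F) {B : ℝ} (hF : ∀ (w : List (Fin d)) (i j : Fin d),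
      |F (wordMap P w (P i)) - F (wordMap P w (P j))| ≤ B * ((d : ℝ) / (d + 2)) ^ w.length)
    {m : ℕ} {X : Space d} (hX : X ∈ interiorVertices P m) :
    |normLaplacian P m f X - F X| ≤ (d + 2) * B * ((d : ℝ) / (d + 2)) ^ m := by
  have hd' : (2 : ℝ) ≤ d := by exact_mod_cast hd
  have key : ∀ {f F : Space d → ℝ}, HasLaplacian P f F → (∀ (w : List (Fin d)) (i j : Fin d),
      |F (wordMap P w (P i)) - F (wordMap P w (P j))| ≤ B * ((d : ℝ) / (d + 2)) ^ w.length) →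
      normLaplacian P m f X - F X ≤ (d + 2) * B * ((d : ℝ) / (d + 2)) ^ m := by
    intro f F hf hF
    obtain ⟨x, X', hX', hx0, hx, hstep, -, hle⟩ := hf.exists_le hd hP hX
    have hB : 0 ≤ B := by
      have := (abs_nonneg _).trans (hF [] ⟨0, by omega⟩ ⟨0, by omega⟩)
      simpa using this
    have hr : (d : ℝ) / (d + 2) < 1 := by rw [div_lt_one (by positivity)]; linarith
    have hlim : Tendsto (fun n => F (x n)) atTop (𝓝 (F X')) := by
      refine (hf.continuousOn_laplacian X' hX').tendsto.comp (tendsto_nhdsWithin_iff.2 ⟨hx, ?_⟩)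
      refine Eventually.of_forall fun n => ?_
      obtain ⟨w, i, j, k, -, hi, -⟩ := hstep n
      rw [← hi]
      exact wordMap_mem_simplex P w i
    -- The corner `j` of the cell `w` is also a vertex of its subcell `j`, which contains `x (n +
    -- 1)`; the path from `x n` goes through it.
    have hdist : ∀ n, dist (F (x n)) (F (x (n + 1))) ≤
        2 * B * (d / (d + 2)) ^ m * ((d : ℝ) / (d + 2)) ^ n := by
      intro n
      obtain ⟨w, i, j, k, hw, hi, hjk⟩ := hstep n
      have h1 := hF w i j
      have h2 := hF (w ++ [j]) j k
      rw [wordMap_snoc, wordMap_snoc, contraction_self, hjk, List.length_append,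
        List.length_singleton, hw, pow_succ] at h2
      rw [hi, hw] at h1
      have h3 : B * (((d : ℝ) / (d + 2)) ^ (m + n) * (d / (d + 2))) ≤
          B * ((d : ℝ) / (d + 2)) ^ (m + n) := by
        gcongr
        exact mul_le_of_le_one_right (by positivity) hr.le
      have h4 : 2 * B * (d / (d + 2)) ^ m * ((d : ℝ) / (d + 2)) ^ n =
          2 * (B * ((d : ℝ) / (d + 2)) ^ (m + n)) := by rw [pow_add]; ring
      rw [h4, Real.dist_eq]
      linarith [abs_sub_le (F (x n)) (F (wordMap P w (P j))) (F (x (n + 1)))]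
    have h := dist_le_of_le_geometric_of_tendsto₀ _ _ hr hdist hlim
    rw [hx0, dist_comm, Real.dist_eq] at h
    have h5 : 2 * B * ((d : ℝ) / (d + 2)) ^ m / (1 - d / (d + 2)) =
        (d + 2) * B * ((d : ℝ) / (d + 2)) ^ m := by
      have : (1 : ℝ) - d / (d + 2) = 2 / (d + 2) := by field_simp; ring
      rw [this]
      field_simp
    rw [h5] at h
    linarith [le_abs_self (F X' - F X)]
  have h1 := key hf hF
  have h2 := key hf.neg fun w i j => by
    have := hF w i j
    rwa [← abs_neg, neg_sub, ← neg_sub_neg] at this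
  rw [normLaplacian_neg] at h2
  exact abs_le.2 ⟨by linarith, h1⟩

/-! ### Rigidity under a strong Hölder condition. -/

theorem wordMap_append_replicate (P : Fin d → Space d) (w : List (Fin d)) (n : ℕ) (i : Fin d) :
    wordMap P (w ++ List.replicate n i) (P i) = wordMap P w (P i) := by
  rw [wordMap_append, wordMap_replicate]

/-- The cells shrink to their common corner `i`, and each level halves the distances. The constant
`K` does not depend on `n`. -/
theorem abs_cornerSum_replicate_le {α C : ℝ}
    (hf : ∀ X ∈ simplex P, ∀ Y ∈ simplex P, |f X - f Y| ≤ C * ‖X - Y‖ ^ α) (w : List (Fin d))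
    (i : Fin d) : ∃ K : ℝ, ∀ n : ℕ,
      |cornerSum P f (w ++ List.replicate n i) i| ≤ K * ((2⁻¹ : ℝ) ^ α) ^ n := by
  refine ⟨∑ k, C * (((2⁻¹ : ℝ) ^ α) ^ w.length * dist (P k) (P i) ^ α), fun n => ?_⟩
  refine (Finset.abs_sum_le_sum_abs _ _).trans ?_
  rw [Finset.sum_mul]
  refine Finset.sum_le_sum fun k _ => ?_
  refine (hf _ (wordMap_mem_simplex P _ k) _ (wordMap_mem_simplex P _ i)).trans_eq ?_
  rw [← dist_eq_norm, dist_wordMap, Real.mul_rpow (by positivity) dist_nonneg,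
    ← Real.rpow_pow_comm (by norm_num), List.length_append, List.length_replicate, pow_add]
  ring

/-- A function with a Laplacian that is Hölder continuous, with an exponent greater than that of
the resistance metric, has Laplacian zero. -/
theorem HasLaplacian.nonpos_of_holder (hd : 2 ≤ d) (hP : AffineIndependent ℝ P)
    (hf : HasLaplacian P f F) {α : ℝ} (hholder : IsHolder P α f)
    (hlt : (2⁻¹ : ℝ) ^ α < d / (d + 2)) {X₀ : Space d} (hX₀ : X₀ ∈ simplex P) : F X₀ ≤ 0 := by
  by_contra! hpos
  have hd' : (2 : ℝ) ≤ d := by exact_mod_cast hd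
  obtain ⟨δ, hδ, hball⟩ := Metric.mem_nhdsWithin_iff.1
    ((hf.continuousOn_laplacian X₀ hX₀).eventually (lt_mem_nhds hpos))
  obtain ⟨X₁, hX₁, hX₁δ⟩ := Metric.mem_closure_iff.1 hX₀ (δ / 2) (by positivity)
  obtain ⟨m, hm⟩ := mem_iUnion.1 hX₁
  obtain ⟨v, hv, i₀, rfl⟩ := (mem_vertices_iff P _ _).1 hm
  set D := Metric.diam (simplex P)
  have hD : 0 ≤ D := Metric.diam_nonneg
  -- The cell `w` must be so small that the vertices in it (within `D / 2 ^ w.length` of its corner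
  -- `i₀`) and the limits from `exists_le` (a further `2 * D / 2 ^ w.length`) stay where `F > 0`.
  -- Appending copies of `i₀` shrinks the cell and keeps that corner.
  obtain ⟨n, hn⟩ := pow_unbounded_of_one_lt (3 * D / (δ / 2)) (one_lt_two : (1 : ℝ) < 2)
  rw [div_lt_iff₀ (by positivity)] at hn
  set w := v ++ List.replicate n i₀ with hw
  have hwX : wordMap P w (P i₀) = wordMap P v (P i₀) := wordMap_append_replicate P v n i₀
  have hwn : 3 * D / 2 ^ w.length < δ / 2 := by
    rw [div_lt_iff₀' (by positivity)]
    refine hn.trans_le ?_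
    gcongr
    · norm_num
    · simp [hw]
  clear_value w
  have hlap : ∀ (u : List (Fin d)) (j k : Fin d), j ≠ k →
      0 < graphLaplacian P ((w ++ u).length + 1) f
        (wordMap P (w ++ u) (contraction P j (P k))) := by
    intro u j k hjk
    obtain ⟨-, Z, hZ, -, -, -, hZd, hle⟩ := hf.neg.exists_le hd hP
      (mem_interiorVertices_iff.2 ⟨wordMap_contraction_mem_vertices P (w ++ u) j k,
        wordMap_contraction_notMem (by omega) hP (w ++ u) hjk⟩)
    set Y := wordMap P (w ++ u) (contraction P j (P k)) with hY
    rw [normLaplacian_neg, normLaplacian] at hle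
    have h1 : dist (wordMap P w (P i₀)) Y ≤ D / 2 ^ w.length := by
      rw [hY, wordMap_append]
      exact dist_wordMap_le (vertex_mem_simplex P i₀)
        (wordMap_mem_simplex' (contraction_mem_simplex (vertex_mem_simplex P k) j) u) w
    have h2 : dist Y Z ≤ 2 * D / 2 ^ w.length := by
      refine hZd.trans ?_
      gcongr
      · norm_num
      · simp only [List.length_append]; omega
    have h3 : 0 < F Z := by
      refine hball ⟨?_, hZ⟩
      rw [Metric.mem_ball, dist_comm]
      have h4 := dist_triangle4 X₀ (wordMap P w (P i₀)) Y Z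
      rw [← hwX] at hX₁δ
      have h5 : 3 * D / 2 ^ w.length = D / 2 ^ w.length + 2 * D / 2 ^ w.length := by ring
      linarith
    have h6 : 0 < normalization d ((w ++ u).length + 1) *
        graphLaplacian P ((w ++ u).length + 1) f Y := by linarith
    exact (pos_iff_pos_of_mul_pos h6).1 (normalization_pos (by omega) _)
  obtain ⟨C, hC⟩ := hholder
  -- Positive graph Laplacians make the rescaled corner sums decrease, and the Hölder condition
  -- makes them tend to zero, so they are positive at each corner. But by antisymmetry the corner
  -- sums of one cell add up to zero.
  have hcorner : ∀ i, 0 < cornerSum P f w i := by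
    intro i
    obtain ⟨K, hK⟩ := abs_cornerSum_replicate_le hC w i
    have hstep : ∀ n, cornerSum P f (w ++ List.replicate (n + 1) i) i * ((d + 2) / d) <
        cornerSum P f (w ++ List.replicate n i) i := by
      intro n
      have h := cornerSum_refine (by omega) hP f (w ++ List.replicate n i) i
      rw [List.append_assoc, ← List.replicate_succ'] at h
      have hE : 0 < ∑ j, ∑ k, splineWeight i j k *
          graphLaplacian P ((w ++ List.replicate n i).length + 1) f
            (wordMap P (w ++ List.replicate n i) (contraction P j (P k))) := by
        have hnn : ∀ j k, 0 ≤ splineWeight i j k *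
            graphLaplacian P ((w ++ List.replicate n i).length + 1) f
              (wordMap P (w ++ List.replicate n i) (contraction P j (P k))) := by
          intro j k
          by_cases hjk : j = k
          · simp [hjk, splineWeight_self]
          · exact mul_nonneg (splineWeight_nonneg i j k) (hlap _ j k hjk).le
        have h01 : (⟨0, by omega⟩ : Fin d) ≠ ⟨1, by omega⟩ := by simp
        refine Finset.sum_pos' (fun j _ => Finset.sum_nonneg fun k _ => hnn j k)
          ⟨⟨0, by omega⟩, Finset.mem_univ _, Finset.sum_pos' (fun k _ => hnn _ k)
            ⟨⟨1, by omega⟩, Finset.mem_univ _, mul_pos (splineWeight_pos i h01) (hlap _ _ _ h01)⟩⟩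
      rw [← mul_div_assoc, div_lt_iff₀ (by positivity)]
      linarith
    have hanti : Antitone fun n =>
        cornerSum P f (w ++ List.replicate n i) i * (((d : ℝ) + 2) / d) ^ n := by
      refine antitone_nat_of_succ_le fun n => ?_
      rw [pow_succ', ← mul_assoc]
      exact mul_le_mul_of_nonneg_right (hstep n).le (by positivity)
    have hlim : Tendsto (fun n => cornerSum P f (w ++ List.replicate n i) i *
        (((d : ℝ) + 2) / d) ^ n) atTop (𝓝 0) := by
      have hq : (2⁻¹ : ℝ) ^ α * ((d + 2) / d) < 1 := by
        rw [← mul_div_assoc, div_lt_one (by positivity)]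
        rwa [lt_div_iff₀ (by positivity)] at hlt
      have h0 := (tendsto_pow_atTop_nhds_zero_of_lt_one (by positivity) hq).const_mul K
      rw [mul_zero] at h0
      refine squeeze_zero_norm (fun n => ?_) h0
      rw [Real.norm_eq_abs, abs_mul, abs_of_nonneg (by positivity : 0 ≤ (((d : ℝ) + 2) / d) ^ n),
        mul_pow, ← mul_assoc]
      exact mul_le_mul_of_nonneg_right (hK n) (by positivity)
    -- The limit only gives a nonnegative value at index 1; the strict step from 0 to 1 gives
    -- positivity.
    have h1 := hanti.le_of_tendsto hlim 1
    have h2 := hstep 0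
    simp only [pow_one] at h1
    simp only [List.replicate_zero, List.append_nil, zero_add] at h2
    exact h1.trans_lt h2
  have hsum : 0 < ∑ i, cornerSum P f w i :=
    Finset.sum_pos (fun i _ => hcorner i) ⟨i₀, Finset.mem_univ _⟩
  exact hsum.ne' (sum_cornerSum P f w)

theorem HasLaplacian.eq_zero_of_holder (hd : 2 ≤ d) (hP : AffineIndependent ℝ P)
    (hf : HasLaplacian P f F) {α : ℝ} (hholder : IsHolder P α f)
    (hlt : (2⁻¹ : ℝ) ^ α < d / (d + 2)) {X : Space d} (hX : X ∈ simplex P) : F X = 0 := by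
  refine le_antisymm (hf.nonpos_of_holder hd hP hholder hlt hX) ?_
  obtain ⟨C, hC⟩ := hholder
  have h := hf.neg.nonpos_of_holder hd hP ⟨C, fun Y hY Z hZ => ?_⟩ hlt hX
  · linarith
  · rw [neg_sub_neg, abs_sub_comm]
    exact hC Y hY Z hZ

/-- A harmonic function that vanishes on the boundary vanishes at all vertices. -/
theorem HasLaplacian.eq_zero_of_laplacian_eq_zero (hd : 2 ≤ d) (hP : AffineIndependent ℝ P)
    (hf : HasLaplacian P f F) (hf0 : ∀ X ∈ vertices P 0, f X = 0)
    (hF : ∀ X ∈ simplex P, F X = 0) (w : List (Fin d)) (i : Fin d) :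
    f (wordMap P w (P i)) = 0 := by
  induction w using List.reverseRecOn generalizing i with
  | nil => exact hf0 _ (mem_vertices_zero P i)
  | append_singleton w a ih =>
    have h := hf.abs_sub_le_pow hd hP hf0 (M := 0) (fun X hX => by simp [hF X hX]) (w ++ [a]) i a
    rw [zero_mul, abs_nonpos_iff, wordMap_snoc P w a (P a), contraction_self, ih a, sub_zero] at h
    exact h

/-! ### Maximum principle, the Euler matrix and solutions of the scheme. -/

/-- The maximum principle for one implicit Euler step. -/
theorem le_of_eulerStep_le {m : ℕ} {h B : ℝ} (hd : 1 ≤ d) (hh : 0 < h) (hB : 0 ≤ B)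
    {f : Space d → ℝ} (hf0 : ∀ X ∈ vertices P 0, f X = 0)
    (hf : ∀ X ∈ interiorVertices P m, f X - h * normLaplacian P m f X ≤ B) {X : Space d}
    (hX : X ∈ vertices P m) : f X ≤ B := by
  classical
  obtain ⟨Z, hZ, hmax⟩ := (vertices P m).exists_max_image f ⟨X, hX⟩
  refine (hmax X hX).trans ?_
  by_cases hZ0 : Z ∈ vertices P 0
  · rw [hf0 Z hZ0]; exact hB
  · have h1 : graphLaplacian P m f Z ≤ 0 := Finset.sum_nonpos fun Y hY =>
      sub_nonpos.2 (hmax Y (Finset.mem_filter.1 hY).1)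
    have h2 : h * normLaplacian P m f Z ≤ 0 := mul_nonpos_of_nonneg_of_nonpos hh.le
      (mul_nonpos_of_nonneg_of_nonpos (normalization_pos hd m).le h1)
    linarith [hf Z (mem_interiorVertices_iff.2 ⟨hZ, hZ0⟩)]

theorem abs_le_of_abs_eulerStep_le {m : ℕ} {h B : ℝ} (hd : 1 ≤ d) (hh : 0 < h) (hB : 0 ≤ B)
    {f : Space d → ℝ} (hf0 : ∀ X ∈ vertices P 0, f X = 0)
    (hf : ∀ X ∈ interiorVertices P m, |f X - h * normLaplacian P m f X| ≤ B) {X : Space d}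
    (hX : X ∈ vertices P m) : |f X| ≤ B := by
  refine abs_le.2 ⟨?_, le_of_eulerStep_le hd hh hB hf0 (fun Y hY => (abs_le.1 (hf Y hY)).2) hX⟩
  have h1 := le_of_eulerStep_le (f := fun X => -f X) hd hh hB
    (fun Y hY => by rw [hf0 Y hY, neg_zero]) (fun Y hY => ?_) hX
  · linarith
  · rw [normLaplacian_neg]
    linarith [(abs_le.1 (hf Y hY)).1]

open scoped Classical in
theorem eulerMatrix_mulVec (hP : AffineIndependent ℝ P) (m : ℕ) (h : ℝ) {f : Space d → ℝ}
    (hf0 : ∀ X ∈ vertices P 0, f X = 0) (X : interiorVertices P m) :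
    (eulerMatrix P m h).mulVec (interiorVector P m f) X = f X - h * normLaplacian P m f X := by
  have hsum : (laplacianMatrix P m).mulVec (interiorVector P m f) X = -normLaplacian P m f X := by
    have h1 : (laplacianMatrix P m).mulVec (interiorVector P m f) X =
        ∑ Y ∈ interiorVertices P m, normalization d m *
          ((if (X : Space d) = Y then
            (((vertices P m).filter (fun Z => Neighbour P m X Z)).card : ℝ) * f Y else 0) -
            if Neighbour P m X Y then f Y else 0) := by
      rw [← Finset.sum_coe_sort]
      refine Finset.sum_congr rfl fun Y _ => ?_
      simp only [laplacianMatrix, Matrix.of_apply, interiorVector]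
      by_cases hXY : X = Y
      · subst hXY
        simp [not_neighbour_self hP, mul_assoc]
      · have hXY' : (X : Space d) ≠ Y := fun h => hXY (Subtype.ext h)
        rw [if_neg hXY, if_neg hXY', zero_sub, mul_assoc]
        split_ifs <;> ring
    -- Boundary neighbours are counted on the diagonal of the matrix but have no column; their
    -- values are zero.
    have h2 : ∑ Y ∈ interiorVertices P m, (if Neighbour P m X Y then f Y else 0) =
        ∑ Y ∈ (vertices P m).filter (fun Y => Neighbour P m X Y), f Y := by
      rw [Finset.sum_filter]
      refine Finset.sum_subset Finset.sdiff_subset fun Y hY hY' => ?_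
      have hY0 : Y ∈ vertices P 0 := by
        by_contra hY0
        exact hY' (mem_interiorVertices_iff.2 ⟨hY, hY0⟩)
      simp [hf0 Y hY0]
    rw [h1, ← Finset.mul_sum, Finset.sum_sub_distrib, h2, Finset.sum_ite_eq, if_pos X.2,
      normLaplacian, graphLaplacian, Finset.sum_sub_distrib, Finset.sum_const, nsmul_eq_mul]
    ring
  rw [eulerMatrix, Matrix.add_mulVec, Matrix.smul_mulVec, Matrix.one_mulVec, Pi.add_apply,
    Pi.smul_apply, hsum, smul_eq_mul, interiorVector]
  ring

open scoped Classical in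
/-- The extension by zero of a vector indexed by the interior vertices. -/
noncomputable def extendZero (P : Fin d → Space d) (m : ℕ) (v : interiorVertices P m → ℝ)
    (X : Space d) : ℝ :=
  if hX : X ∈ interiorVertices P m then v ⟨X, hX⟩ else 0

theorem extendZero_boundary (m : ℕ) (v : interiorVertices P m → ℝ) {X : Space d}
    (hX : X ∈ vertices P 0) : extendZero P m v X = 0 :=
  dif_neg fun h => (mem_interiorVertices_iff.1 h).2 hX

theorem interiorVector_extendZero (m : ℕ) (v : interiorVertices P m → ℝ) :
    interiorVector P m (extendZero P m v) = v := by
  funext X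
  simp [interiorVector, extendZero]

-- The maximum principle in matrix form. It gives injectivity, hence invertibility, and shows that
-- the inverse is a contraction in the sup norm.
open scoped Classical in
theorem norm_le_norm_eulerMatrix_mulVec (hd : 1 ≤ d) (hP : AffineIndependent ℝ P) (m : ℕ)
    {h : ℝ} (hh : 0 < h) (v : interiorVertices P m → ℝ) :
    ‖v‖ ≤ ‖(eulerMatrix P m h).mulVec v‖ := by
  have h0 : ∀ X ∈ vertices P 0, extendZero P m v X = 0 := fun X hX => extendZero_boundary m v hX
  refine (pi_norm_le_iff_of_nonneg (norm_nonneg _)).2 fun X => ?_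
  rw [Real.norm_eq_abs, ← congrFun (interiorVector_extendZero m v) X]
  refine abs_le_of_abs_eulerStep_le hd hh (norm_nonneg _) h0 (fun Y hY => ?_)
    (mem_interiorVertices_iff.1 X.2).1
  have h1 := eulerMatrix_mulVec hP m h h0 ⟨Y, hY⟩
  rw [interiorVector_extendZero] at h1
  rw [← h1]
  exact norm_le_pi_norm ((eulerMatrix P m h).mulVec v) ⟨Y, hY⟩

open scoped Classical in
theorem isUnit_eulerMatrix (hd : 1 ≤ d) (hP : AffineIndependent ℝ P) (m : ℕ) {h : ℝ}
    (hh : 0 < h) : IsUnit (eulerMatrix P m h) := by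
  rw [← Matrix.mulVec_injective_iff_isUnit]
  intro v w hvw
  have h1 := norm_le_norm_eulerMatrix_mulVec hd hP m hh (v - w)
  rw [Matrix.mulVec_sub, sub_eq_zero.2 hvw, norm_zero] at h1
  exact sub_eq_zero.1 (norm_le_zero_iff.1 h1)

open scoped Classical in
theorem eulerMatrix_mulVec_inv (hd : 1 ≤ d) (hP : AffineIndependent ℝ P) (m : ℕ) {h : ℝ}
    (hh : 0 < h) (v : interiorVertices P m → ℝ) :
    (eulerMatrix P m h).mulVec ((eulerMatrix P m h)⁻¹.mulVec v) = v := by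
  rw [Matrix.mulVec_mulVec, Matrix.mul_nonsing_inv _
    ((Matrix.isUnit_iff_isUnit_det _).1 (isUnit_eulerMatrix hd hP m hh)), Matrix.one_mulVec]

theorem linftyOpNorm_le_one {ι : Type*} [Fintype ι] {A : Matrix ι ι ℝ}
    (hA : ∀ v, ‖A.mulVec v‖ ≤ ‖v‖) : ‖A‖ ≤ 1 := by
  classical
  have h := Matrix.linfty_opNorm_eq_opNorm A
  refine h.trans_le (ContinuousLinearMap.opNorm_le_bound _ zero_le_one fun v => ?_)
  rw [one_mul]
  exact hA v

open scoped Classical in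
theorem norm_eulerMatrix_inv_pow_le (hd : 1 ≤ d) (hP : AffineIndependent ℝ P) (m : ℕ) {h : ℝ}
    (hh : 0 < h) (n : ℕ) : ‖(eulerMatrix P m h)⁻¹ ^ n‖ ≤ 1 := by
  refine linftyOpNorm_le_one fun v => ?_
  induction n with
  | zero => rw [pow_zero, Matrix.one_mulVec]
  | succ n ih =>
    rw [pow_succ', ← Matrix.mulVec_mulVec]
    refine (norm_le_norm_eulerMatrix_mulVec hd hP m hh _).trans ?_
    rw [eulerMatrix_mulVec_inv hd hP m hh]
    exact ih

theorem IsImplicitEuler.sub_eq {m N : ℕ} {h : ℝ} {g : Space d → ℝ} {U : ℕ → Space d → ℝ}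
    (hh : 0 < h) (hU : IsImplicitEuler P m h N g U) {k : ℕ} (hk : k < N) {X : Space d}
    (hX : X ∈ interiorVertices P m) :
    U (k + 1) X - h * normLaplacian P m (U (k + 1)) X = U k X := by
  have h1 := hU.step k hk X hX
  rw [div_eq_iff hh.ne'] at h1
  rw [normLaplacian]
  linarith

open scoped Classical in
theorem IsImplicitEuler.eulerMatrix_mulVec_eq (hP : AffineIndependent ℝ P) {m N : ℕ} {h : ℝ}
    {g : Space d → ℝ} {U : ℕ → Space d → ℝ} (hh : 0 < h) (hU : IsImplicitEuler P m h N g U)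
    {k : ℕ} (hk : k < N) :
    (eulerMatrix P m h).mulVec (interiorVector P m (U (k + 1))) = interiorVector P m (U k) := by
  funext X
  rw [eulerMatrix_mulVec hP m h (hU.boundary (k + 1) hk), hU.sub_eq hh hk X.2]
  rfl

theorem IsImplicitEuler.norm_le (hd : 1 ≤ d) (hP : AffineIndependent ℝ P) {m N : ℕ} {h : ℝ}
    {g : Space d → ℝ} {U : ℕ → Space d → ℝ} (hh : 0 < h) (hU : IsImplicitEuler P m h N g U)
    {k : ℕ} (hk : k ≤ N) : ‖interiorVector P m (U k)‖ ≤ ‖interiorVector P m (U 0)‖ := by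
  classical
  induction k with
  | zero => exact le_rfl
  | succ k ih =>
    refine (norm_le_norm_eulerMatrix_mulVec hd hP m hh _).trans ?_
    rw [hU.eulerMatrix_mulVec_eq hP hh hk]
    exact ih (Nat.le_of_succ_le hk)

/-- Stability of the scheme with respect to a source term. -/
theorem abs_le_of_abs_residual_le (hd : 1 ≤ d) {m N : ℕ} {h τ : ℝ} (hh : 0 < h) (hτ : 0 ≤ τ)
    {e : ℕ → Space d → ℝ} (he0 : ∀ k ≤ N, ∀ X ∈ vertices P 0, e k X = 0)
    (hinit : ∀ X ∈ interiorVertices P m, e 0 X = 0)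
    (hstep : ∀ k < N, ∀ X ∈ interiorVertices P m,
      |(e (k + 1) X - e k X) / h - normLaplacian P m (e (k + 1)) X| ≤ τ)
    {k : ℕ} (hk : k ≤ N) {X : Space d} (hX : X ∈ vertices P m) : |e k X| ≤ k * (h * τ) := by
  induction k generalizing X with
  | zero =>
    have : e 0 X = 0 := by
      by_cases hX0 : X ∈ vertices P 0
      · exact he0 0 hk X hX0
      · exact hinit X (mem_interiorVertices_iff.2 ⟨hX, hX0⟩)
    simp [this]
  | succ k ih =>
    refine abs_le_of_abs_eulerStep_le hd hh (by positivity) (he0 (k + 1) hk) (fun Y hY => ?_) hX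
    have h1 := ih (Nat.le_of_succ_le hk) (mem_interiorVertices_iff.1 hY).1
    have h2 := hstep k hk Y hY
    have h3 : e (k + 1) Y - h * normLaplacian P m (e (k + 1)) Y = e k Y +
        h * ((e (k + 1) Y - e k Y) / h - normLaplacian P m (e (k + 1)) Y) := by
      field_simp
      ring
    rw [h3]
    refine (abs_add_le _ _).trans ?_
    rw [abs_mul, abs_of_pos hh]
    have h4 := mul_le_mul_of_nonneg_left h2 hh.le
    push_cast
    linarith

/-- By linearity, the difference of two solutions satisfies the scheme with zero data and zero
residual. -/
theorem IsImplicitEuler.eq (hd : 1 ≤ d) {m N : ℕ} {h : ℝ}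
    {g : Space d → ℝ} {U U' : ℕ → Space d → ℝ} (hh : 0 < h) (hU : IsImplicitEuler P m h N g U)
    (hU' : IsImplicitEuler P m h N g U') {k : ℕ} (hk : k ≤ N) {X : Space d}
    (hX : X ∈ vertices P m) : U' k X = U k X := by
  have h1 := abs_le_of_abs_residual_le (P := P) (m := m) (N := N)
    (e := fun k X => U' k X - U k X) hd hh le_rfl
    (fun k hk Y hY => by rw [hU.boundary k hk Y hY, hU'.boundary k hk Y hY, sub_zero])
    (fun Y hY => by rw [hU.initial Y hY, hU'.initial Y hY, sub_self])
    (fun k hk Y hY => by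
      have h1 := hU.step k hk Y hY
      have h2 := hU'.step k hk Y hY
      rw [normLaplacian, graphLaplacian_sub, mul_sub, ← h1, ← h2, abs_nonpos_iff]
      ring) hk hX
  rw [mul_zero, mul_zero, abs_nonpos_iff] at h1
  exact sub_eq_zero.1 h1

theorem exists_isImplicitEuler (hd : 1 ≤ d) (hP : AffineIndependent ℝ P) (m : ℕ) {h : ℝ} (N : ℕ)
    (g : Space d → ℝ) (hh : 0 < h) : ∃ U, IsImplicitEuler P m h N g U := by
  classical
  let V : ℕ → interiorVertices P m → ℝ := fun k =>
    ((eulerMatrix P m h)⁻¹.mulVec)^[k] (interiorVector P m g)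
  refine ⟨fun k => extendZero P m (V k), fun k _ X hX => ?_,
    fun k _ X hX => extendZero_boundary m _ hX, fun X hX => ?_⟩
  · have h1 := eulerMatrix_mulVec hP m h
      (fun X hX => extendZero_boundary m (V (k + 1)) hX) ⟨X, hX⟩
    have h2 : (eulerMatrix P m h).mulVec (V (k + 1)) = V k := by
      simp only [V, Function.iterate_succ_apply']
      exact eulerMatrix_mulVec_inv hd hP m hh _
    rw [interiorVector_extendZero, h2, ← congrFun (interiorVector_extendZero m (V k)) ⟨X, hX⟩]
      at h1
    simp only [interiorVector, normLaplacian] at h1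
    rw [div_eq_iff hh.ne']
    linarith
  · exact congrFun (interiorVector_extendZero m (V 0)) ⟨X, hX⟩

/-! ### From the sup norm to the discrete norm. -/

theorem card_vertices_le (P : Fin d → Space d) (m : ℕ) :
    (vertices P m).card ≤ d ^ (m + 1) := by
  induction m with
  | zero => simpa [vertices] using Finset.card_image_le (s := Finset.univ) (f := P)
  | succ m ih =>
    rw [vertices]
    refine Finset.card_biUnion_le.trans ?_
    refine (Finset.sum_le_card_nsmul _ _ _ fun i _ => Finset.card_image_le.trans ih).trans_eq ?_
    rw [Finset.card_univ, Fintype.card_fin, smul_eq_mul, ← pow_succ']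

theorem normTwoInfty_le (hd : 1 ≤ d) {m N : ℕ} {w : ℕ → Space d → ℝ} {E : ℝ} (hE : 0 ≤ E)
    (hw : ∀ k ≤ N, ∀ X ∈ vertices P m, |w k X| ≤ E) : normTwoInfty P m N w ≤ √d * E := by
  have hd' : (1 : ℝ) ≤ d := by exact_mod_cast hd
  refine Finset.sup'_le _ _ fun k hk => ?_
  rw [← Real.sqrt_sq hE, ← Real.sqrt_mul (by positivity)]
  refine Real.sqrt_le_sqrt ?_
  have h1 : ∑ X ∈ vertices P m, |w k X| ^ 2 ≤ (d : ℝ) ^ (m + 1) * E ^ 2 := by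
    refine (Finset.sum_le_card_nsmul _ _ (E ^ 2) fun X hX => ?_).trans ?_
    · exact pow_le_pow_left₀ (abs_nonneg _)
        (hw k (Nat.lt_succ_iff.1 (Finset.mem_range.1 hk)) X hX) 2
    · rw [nsmul_eq_mul]
      gcongr
      exact_mod_cast card_vertices_le P m
  refine (mul_le_mul_of_nonneg_left h1 (by positivity)).trans_eq ?_
  rw [pow_succ]
  field_simp

theorem normTwoInfty_nonneg (P : Fin d → Space d) (m N : ℕ) (w : ℕ → Space d → ℝ) :
    0 ≤ normTwoInfty P m N w :=
  (Real.sqrt_nonneg _).trans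
    (Finset.le_sup' (fun k => √(((d : ℝ) ^ m)⁻¹ * ∑ X ∈ vertices P m, |w k X| ^ 2))
      (Finset.mem_range.2 (Nat.succ_pos N)))

theorem HasLaplacian.congr_right {f F G : Space d → ℝ} (hf : HasLaplacian P f F)
    (h : ∀ X ∈ simplex P, F X = G X) : HasLaplacian P f G where
  continuousOn := hf.continuousOn
  continuousOn_laplacian := hf.continuousOn_laplacian.congr fun X hX => (h X hX).symm
  tendsto X hX := h X hX ▸ hf.tendsto X hX

/-- For `d = 1` there is one word of each length, hence no second cell. This disposes of the
degenerate case in the error estimates. -/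
theorem two_le_of_mem_interiorVertices (hd : 1 ≤ d) (hP : AffineIndependent ℝ P) {m : ℕ}
    {X : Space d} (hX : X ∈ interiorVertices P m) : 2 ≤ d := by
  by_contra hd2
  obtain ⟨hXm, hX0⟩ := mem_interiorVertices_iff.1 hX
  obtain ⟨v, -, l, rfl⟩ := (mem_vertices_iff P _ _).1 hXm
  obtain ⟨w, w', i, i', hw, hw', hne, -⟩ := exists_two_addresses hd hP v l hX0
  have hs : ∀ a : Fin d, a = l := fun a => Fin.ext (by omega)
  exact hne ((List.eq_replicate_iff.2 ⟨hw, fun a _ => hs a⟩).trans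
    (List.eq_replicate_iff.2 ⟨hw', fun a _ => hs a⟩).symm)

/-! ### Time discretization and error estimates for heat solutions. -/

theorem abs_sub_le_of_hasDerivWithinAt {φ φ' : ℝ → ℝ} {a b M : ℝ}
    (hφ : ∀ t ∈ Icc a b, HasDerivWithinAt φ (φ' t) (Icc a b) t)
    (hM : ∀ t ∈ Icc a b, |φ' t| ≤ M) {s t : ℝ} (hs : s ∈ Icc a b) (ht : t ∈ Icc a b) :
    |φ s - φ t| ≤ M * |s - t| :=
  (convex_Icc a b).norm_image_sub_le_of_norm_hasDerivWithin_le hφ hM ht hs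

/-- The error of the backward difference quotient. -/
theorem abs_backward_difference_sub_le {φ φ' φ'' : ℝ → ℝ} {T M : ℝ}
    (hφ : ∀ t ∈ Icc 0 T, HasDerivWithinAt φ (φ' t) (Icc 0 T) t)
    (hφ' : ∀ t ∈ Icc 0 T, HasDerivWithinAt φ' (φ'' t) (Icc 0 T) t)
    (hM : ∀ t ∈ Icc 0 T, |φ'' t| ≤ M) {a b : ℝ} (ha : 0 ≤ a) (hab : a < b) (hb : b ≤ T) :
    |(φ b - φ a) / (b - a) - φ' b| ≤ M * (b - a) := by
  have hsub : Icc a b ⊆ Icc 0 T := Icc_subset_Icc ha hb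
  have hbm : b ∈ Icc a b := right_mem_Icc.2 hab.le
  have hM0 : 0 ≤ M := (abs_nonneg _).trans (hM b (hsub hbm))
  -- Removing the linear part at `b` leaves a function with derivative at most `M * (b - a)` on `[a,
  -- b]`.
  have h1 := abs_sub_le_of_hasDerivWithinAt (φ := fun s => φ s - s * φ' b)
    (φ' := fun s => φ' s - 1 * φ' b) (a := a) (b := b) (M := M * (b - a))
    (fun t ht => ((hφ t (hsub ht)).mono hsub).sub ((hasDerivWithinAt_id t _).mul_const _))
    (fun t ht => by
      rw [one_mul]
      refine (abs_sub_le_of_hasDerivWithinAt hφ' hM (hsub ht) (hsub hbm)).trans ?_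
      rw [abs_sub_comm, abs_of_nonneg (sub_nonneg.2 ht.2)]
      exact mul_le_mul_of_nonneg_left (sub_le_sub_left ht.1 b) hM0)
    hbm (left_mem_Icc.2 hab.le)
  have hpos : 0 < b - a := sub_pos.2 hab
  have h2 : (φ b - φ a) / (b - a) - φ' b =
      ((φ b - b * φ' b) - (φ a - a * φ' b)) / (b - a) := by
    field_simp
    ring
  rw [h2, abs_div, abs_of_pos hpos, div_le_iff₀ hpos]
  rwa [abs_of_pos hpos] at h1

/-- The heat equation is given only inside the time interval, but the last step of the scheme is
evaluated at `T`. -/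
theorem abs_le_of_forall_Ioo {φ : ℝ → ℝ} {T B : ℝ} (hT : 0 < T) (hφ : ContinuousOn φ (Icc 0 T))
    (hB : ∀ t ∈ Ioo 0 T, |φ t| ≤ B) {t : ℝ} (ht : t ∈ Icc 0 T) : |φ t| ≤ B := by
  rw [← closure_Ioo hT.ne] at hφ ht
  exact le_on_closure (f := fun t => |φ t|) hB hφ.abs continuousOn_const ht

section HeatSolution

variable {T : ℝ} {g : Space d → ℝ} {u u' u'' : ℝ → Space d → ℝ} {M : ℝ}

theorem IsHeatSolution.hasLaplacian (hu : IsHeatSolution P T g u)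
    (hu' : ∀ X ∈ simplex P, ∀ t ∈ Icc 0 T,
      HasDerivWithinAt (fun s => u s X) (u' t X) (Icc 0 T) t) {t : ℝ} (ht : t ∈ Ioo 0 T) :
    HasLaplacian P (u t) (u' t) := by
  obtain ⟨F, hF, hFu⟩ := hu.heat t ht
  exact hF.congr_right fun X hX => (hFu X hX).unique
    ((hu' X hX t (Ioo_subset_Icc_self ht)).hasDerivAt (Icc_mem_nhds ht.1 ht.2))

/-- The time derivative of a solution is Lipschitz continuous in the resistance metric, uniformly
in time. -/
theorem IsHeatSolution.abs_deriv_sub_le (hd : 2 ≤ d) (hP : AffineIndependent ℝ P)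
    (hu : IsHeatSolution P T g u)
    (hu' : ∀ X ∈ simplex P, ∀ t ∈ Icc 0 T,
      HasDerivWithinAt (fun s => u s X) (u' t X) (Icc 0 T) t)
    (hu'' : ∀ X ∈ simplex P, ∀ t ∈ Icc 0 T,
      HasDerivWithinAt (fun s => u' s X) (u'' t X) (Icc 0 T) t)
    (hM : ∀ X ∈ simplex P, ∀ t ∈ Icc 0 T, |u'' t X| ≤ M) {t : ℝ} (ht : t ∈ Ioo 0 T)
    (w : List (Fin d)) (i j : Fin d) :
    |u' t (wordMap P w (P i)) - u' t (wordMap P w (P j))| ≤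
      M * ((d : ℝ) / (d + 2)) ^ w.length := by
  have hM0 : 0 ≤ M :=
    (abs_nonneg _).trans (hM _ (vertex_mem_simplex P i) t (Ioo_subset_Icc_self ht))
  have hderiv : ∀ X ∈ simplex P, HasDerivAt (fun s => u s X) (u' t X) t := fun X hX =>
    (hu' X hX t (Ioo_subset_Icc_self ht)).hasDerivAt (Icc_mem_nhds ht.1 ht.2)
  -- The derivative at `t` is bounded by the Lipschitz constant at `t` of the difference of `u` at
  -- the two vertices; the oscillation bound for `u s - u t` supplies it.
  refine ((hderiv _ (wordMap_mem_simplex P w i)).sub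
    (hderiv _ (wordMap_mem_simplex P w j))).le_of_lip' (by positivity) ?_
  filter_upwards [Ioo_mem_nhds ht.1 ht.2] with s hs
  have h := ((hu.hasLaplacian hu' hs).sub (hu.hasLaplacian hu' ht)).abs_sub_le_pow hd hP
    (fun X hX => by
      rw [hu.boundary s (Ioo_subset_Ico_self hs) X hX,
        hu.boundary t (Ioo_subset_Ico_self ht) X hX, sub_zero])
    (M := M * |s - t|) (fun X hX => abs_sub_le_of_hasDerivWithinAt (hu'' X hX) (hM X hX)
      (Ioo_subset_Icc_self hs) (Ioo_subset_Icc_self ht)) w i j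
  rw [Real.norm_eq_abs, Real.norm_eq_abs]
  calc |_| = |u s (wordMap P w (P i)) - u t (wordMap P w (P i)) -
        (u s (wordMap P w (P j)) - u t (wordMap P w (P j)))| := by
        simp only [Pi.sub_apply]
        congr 1
        ring
    _ ≤ _ := h.trans_eq (by ring)

theorem continuousOn_normLaplacian (hu : ∀ X ∈ simplex P, ContinuousOn (fun t => u t X) (Icc 0 T))
    {m : ℕ} {X : Space d} (hX : X ∈ simplex P) :
    ContinuousOn (fun t => normLaplacian P m (u t) X) (Icc 0 T) := by
  classical
  exact continuousOn_const.mul (continuousOn_finsetSum _ fun Y hY =>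
    (hu Y (vertices_subset_simplex P m (Finset.mem_filter.1 hY).1)).sub (hu X hX))

/-- The consistency of the space discretization. -/
theorem IsHeatSolution.abs_normLaplacian_sub_le (hT : 0 < T) (hd : 2 ≤ d)
    (hP : AffineIndependent ℝ P) (hu : IsHeatSolution P T g u)
    (hu' : ∀ X ∈ simplex P, ∀ t ∈ Icc 0 T,
      HasDerivWithinAt (fun s => u s X) (u' t X) (Icc 0 T) t)
    (hu'' : ∀ X ∈ simplex P, ∀ t ∈ Icc 0 T,
      HasDerivWithinAt (fun s => u' s X) (u'' t X) (Icc 0 T) t)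
    (hM : ∀ X ∈ simplex P, ∀ t ∈ Icc 0 T, |u'' t X| ≤ M) {m : ℕ} {X : Space d}
    (hX : X ∈ interiorVertices P m) {t : ℝ} (ht : t ∈ Icc 0 T) :
    |normLaplacian P m (u t) X - u' t X| ≤ (d + 2) * M * ((d : ℝ) / (d + 2)) ^ m := by
  have hXs := interiorVertices_subset_simplex hX
  refine abs_le_of_forall_Ioo (φ := fun t => normLaplacian P m (u t) X - u' t X) hT ?_
    (fun s hs => ?_) ht
  · exact (continuousOn_normLaplacian
      (fun Y hY s hs => (hu' Y hY s hs).continuousWithinAt) hXs).sub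
      fun s hs => (hu'' X hXs s hs).continuousWithinAt
  · exact (hu.hasLaplacian hu' hs).abs_normLaplacian_sub_le hd hP
      (hu.abs_deriv_sub_le hd hP hu' hu'' hM hs) hX

theorem IsHeatSolution.boundary_Icc (hT : 0 < T) (hu : IsHeatSolution P T g u)
    (hu' : ∀ X ∈ simplex P, ∀ t ∈ Icc 0 T,
      HasDerivWithinAt (fun s => u s X) (u' t X) (Icc 0 T) t) {t : ℝ} (ht : t ∈ Icc 0 T)
    {X : Space d} (hX : X ∈ vertices P 0) : u t X = 0 :=
  abs_nonpos_iff.1 (abs_le_of_forall_Ioo (φ := fun t => u t X) hT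
    (fun s hs => (hu' X (vertices_subset_simplex P 0 hX) s hs).continuousWithinAt)
    (fun s hs => by rw [hu.boundary s (Ioo_subset_Ico_self hs) X hX, abs_zero]) ht)

theorem natCast_mul_div_mem_Icc (hT : 0 < T) {k N : ℕ} (hN : 1 ≤ N) (hk : k ≤ N) :
    (k : ℝ) * (T / N) ∈ Icc 0 T := by
  have hN' : (0 : ℝ) < N := by exact_mod_cast hN
  refine ⟨by positivity, ?_⟩
  rw [← mul_div_assoc, div_le_iff₀ hN', mul_comm]
  have : (k : ℝ) ≤ N := by exact_mod_cast hk
  gcongr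

/-- The error of the implicit Euler scheme, in the sup norm. -/
theorem IsHeatSolution.abs_error_le (hT : 0 < T) (hd : 1 ≤ d) (hP : AffineIndependent ℝ P)
    (hu : IsHeatSolution P T g u)
    (hu' : ∀ X ∈ simplex P, ∀ t ∈ Icc 0 T,
      HasDerivWithinAt (fun s => u s X) (u' t X) (Icc 0 T) t)
    (hu'' : ∀ X ∈ simplex P, ∀ t ∈ Icc 0 T,
      HasDerivWithinAt (fun s => u' s X) (u'' t X) (Icc 0 T) t)
    (hM : ∀ X ∈ simplex P, ∀ t ∈ Icc 0 T, |u'' t X| ≤ M) {m N : ℕ} (hN : 1 ≤ N)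
    {U : ℕ → Space d → ℝ} (hU : IsImplicitEuler P m (T / N) N g U) {k : ℕ} (hk : k ≤ N)
    {X : Space d} (hX : X ∈ vertices P m) :
    |u (k * (T / N)) X - U k X| ≤
      T * ((d + 2) * M * (T / N + ((d : ℝ) / (d + 2)) ^ m)) := by
  have hN' : (0 : ℝ) < N := by exact_mod_cast hN
  have hh : 0 < T / N := by positivity
  have hM0 : 0 ≤ M := (abs_nonneg _).trans
    (hM X (vertices_subset_simplex P m hX) 0 (left_mem_Icc.2 hT.le))
  have hres : ∀ k < N, ∀ Y ∈ interiorVertices P m,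
      |((u ((k + 1 : ℕ) * (T / N)) Y - U (k + 1) Y) - (u (k * (T / N)) Y - U k Y)) / (T / N) -
        normLaplacian P m (fun Y => u ((k + 1 : ℕ) * (T / N)) Y - U (k + 1) Y) Y| ≤
      (d + 2) * M * (T / N + ((d : ℝ) / (d + 2)) ^ m) := by
    intro k hk Y hY
    have hYs := interiorVertices_subset_simplex hY
    have hd2 := two_le_of_mem_interiorVertices hd hP hY
    have hmem := natCast_mul_div_mem_Icc hT hN (Nat.succ_le_of_lt hk)
    have hmem0 := natCast_mul_div_mem_Icc hT hN hk.le
    have hdiff : (k + 1 : ℕ) * (T / N) - k * (T / N) = T / N := by push_cast; ring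
    have h1 := abs_backward_difference_sub_le (hu' Y hYs) (hu'' Y hYs) (hM Y hYs) hmem0.1
      (by linarith) hmem.2
    rw [hdiff] at h1
    have h2 := hu.abs_normLaplacian_sub_le hT hd2 hP hu' hu'' hM hY hmem
    have h3 := hU.step k hk Y hY
    rw [← normLaplacian] at h3
    have h4 : normLaplacian P m (fun Y => u ((k + 1 : ℕ) * (T / N)) Y - U (k + 1) Y) Y =
        normLaplacian P m (u ((k + 1 : ℕ) * (T / N))) Y - (U (k + 1) Y - U k Y) / (T / N) := by
      rw [h3, normLaplacian, graphLaplacian_sub, mul_sub, normLaplacian, normLaplacian]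
    rw [h4]
    set a := u ((k + 1 : ℕ) * (T / N)) Y
    set a' := u' ((k + 1 : ℕ) * (T / N)) Y
    set L := normLaplacian P m (u ((k + 1 : ℕ) * (T / N))) Y
    have h5 : (a - U (k + 1) Y - (u (k * (T / N)) Y - U k Y)) / (T / N) -
        (L - (U (k + 1) Y - U k Y) / (T / N)) =
        ((a - u (k * (T / N)) Y) / (T / N) - a') - (L - a') := by
      ring
    rw [h5]
    refine (abs_sub _ _).trans ((add_le_add h1 h2).trans ?_)
    have h6 : M * (T / N) ≤ (d + 2) * M * (T / N) := by
      gcongr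
      have : (0 : ℝ) ≤ d := by positivity
      nlinarith
    rw [mul_add]
    linarith
  refine (abs_le_of_abs_residual_le (e := fun k X => u (k * (T / N)) X - U k X) hd hh
    (by positivity) (fun k hk Y hY => ?_) (fun Y hY => ?_) hres hk hX).trans ?_
  · rw [hu.boundary_Icc hT hu' (natCast_mul_div_mem_Icc hT hN hk) hY, hU.boundary k hk Y hY,
      sub_zero]
  · rw [Nat.cast_zero, zero_mul, hu.initial Y (interiorVertices_subset_simplex hY),
      hU.initial Y hY, sub_self]
  · rw [← mul_assoc]
    exact mul_le_mul_of_nonneg_right (natCast_mul_div_mem_Icc hT hN hk).2 (by positivity)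

/-- A solution that is Hölder continuous, with an exponent greater than that of the resistance
metric, vanishes, and so does its approximation. -/
theorem IsHeatSolution.error_eq_zero (hT : 0 < T) (hd : 1 ≤ d) (hP : AffineIndependent ℝ P)
    (hu : IsHeatSolution P T g u)
    (hu' : ∀ X ∈ simplex P, ∀ t ∈ Icc 0 T,
      HasDerivWithinAt (fun s => u s X) (u' t X) (Icc 0 T) t)
    {α : ℝ} (hholder : ∀ t ∈ Ioo 0 T, IsHolder P α (u t))
    (hlt : (2⁻¹ : ℝ) ^ α < d / (d + 2)) {m N : ℕ} (hN : 1 ≤ N)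
    {U : ℕ → Space d → ℝ} (hU : IsImplicitEuler P m (T / N) N g U) {k : ℕ} (hk : k ≤ N)
    {X : Space d} (hX : X ∈ vertices P m) : u (k * (T / N)) X - U k X = 0 := by
  have hN' : (0 : ℝ) < N := by exact_mod_cast hN
  have hzero : ∀ t ∈ Icc 0 T, ∀ Y ∈ vertices P m, u t Y = 0 := by
    intro t ht Y hY
    by_cases hY0 : Y ∈ vertices P 0
    · exact hu.boundary_Icc hT hu' ht hY0
    · have hd2 := two_le_of_mem_interiorVertices hd hP (mem_interiorVertices_iff.2 ⟨hY, hY0⟩)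
      refine abs_nonpos_iff.1 (abs_le_of_forall_Ioo (φ := fun t => u t Y) hT
        (fun s hs => (hu' Y (vertices_subset_simplex P m hY) s hs).continuousWithinAt)
        (fun s hs => ?_) ht)
      obtain ⟨w, -, i, rfl⟩ := (mem_vertices_iff P _ _).1 hY
      have hL := hu.hasLaplacian hu' hs
      rw [hL.eq_zero_of_laplacian_eq_zero hd2 hP (hu.boundary s (Ioo_subset_Ico_self hs))
        (fun Z hZ => hL.eq_zero_of_holder hd2 hP (hholder s hs) hlt hZ) w i, abs_zero]
  -- The initial data `g` agree with `u 0`, which is zero on the vertices, so stability with zero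
  -- residual applies to `U`.
  have hU0 : |U k X| ≤ k * (T / N * 0) := by
    refine abs_le_of_abs_residual_le (P := P) (m := m) (N := N) hd (by positivity) le_rfl
      hU.boundary (fun Y hY => ?_) (fun l hl Y hY => ?_) hk hX
    · have hYs := interiorVertices_subset_simplex hY
      rw [hU.initial Y hY, ← hu.initial Y hYs,
        hzero 0 (left_mem_Icc.2 hT.le) Y (mem_interiorVertices_iff.1 hY).1]
    · rw [hU.step l hl Y hY, normLaplacian, sub_self, abs_zero]
  rw [mul_zero, mul_zero, abs_nonpos_iff] at hU0
  rw [hU0, hzero _ (natCast_mul_div_mem_Icc hT hN hk) X hX, sub_zero]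

end HeatSolution

theorem inv_two_rpow_pow (α : ℝ) (m : ℕ) : ((2⁻¹ : ℝ) ^ α) ^ m = (2 : ℝ) ^ (-(m * α)) := by
  rw [Real.inv_rpow (by norm_num), ← Real.rpow_neg (by norm_num), ← Real.rpow_natCast,
    ← Real.rpow_mul (by norm_num)]
  congr 1
  ring

end SierpinskiHeat

open SierpinskiHeat in
open scoped Classical in
theorem mainTheorem3 (d : ℕ) (hd : 1 ≤ d) (P : Fin d → Space d) (hP : AffineIndependent ℝ P) :
    -- the matrix of the scheme is invertible, and its inverse is bounded by 1 in the sup norm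
    (∀ (m : ℕ) (h : ℝ), 0 < h →
      IsUnit (eulerMatrix P m h) ∧ ‖(eulerMatrix P m h)⁻¹‖ ≤ 1 ∧
        ∀ n : ℕ, ‖(eulerMatrix P m h)⁻¹ ^ n‖ ≤ 1) ∧
    -- the scheme has exactly one solution
    (∀ (m : ℕ) (h : ℝ) (N : ℕ) (g : Space d → ℝ), 0 < h →
      ∃ U, IsImplicitEuler P m h N g U ∧
        ∀ U', IsImplicitEuler P m h N g U' → ∀ k ≤ N, ∀ X ∈ vertices P m, U' k X = U k X) ∧
    -- matrix form of the scheme, and unconditional stability in the sup norm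
    (∀ (m : ℕ) (h : ℝ) (N : ℕ) (g : Space d → ℝ) (U : ℕ → Space d → ℝ), 0 < h →
      IsImplicitEuler P m h N g U →
        (∀ k < N, (eulerMatrix P m h).mulVec (interiorVector P m (U (k + 1))) =
          interiorVector P m (U k)) ∧
        ∀ k ≤ N, ‖interiorVector P m (U k)‖ ≤ ‖interiorVector P m (U 0)‖) ∧
    -- error bound and convergence, without a restriction that links `T / N` and `m`
    (∀ (T α : ℝ) (g : Space d → ℝ) (u : ℝ → Space d → ℝ), 0 < T → 0 ≤ α →
      IsHeatSolution P T g u → HasBoundedSecondTimeDeriv P T u →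
      (∀ t ∈ Set.Ioo 0 T, IsHolder P α (u t)) →
        (∃ C : ℝ, ∀ (m N : ℕ) (U : ℕ → Space d → ℝ), 1 ≤ N →
          IsImplicitEuler P m (T / N) N g U →
            normTwoInfty P m N (fun k X => u (k * (T / N)) X - U k X) ≤
              C * (T / N + (2 : ℝ) ^ (-(m * α)))) ∧
        ∀ U : ℕ → ℕ → ℕ → Space d → ℝ,
          (∀ m N : ℕ, 1 ≤ N → IsImplicitEuler P m (T / N) N g (U m N)) →
            Filter.Tendsto
              (fun p : ℕ × ℕ =>
                normTwoInfty P p.1 p.2 (fun k X => u (k * (T / p.2)) X - U p.1 p.2 k X))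
              (Filter.atTop ×ˢ Filter.atTop) (nhds 0)) := by
  refine ⟨fun m h hh => ⟨isUnit_eulerMatrix hd hP m hh, ?_, norm_eulerMatrix_inv_pow_le hd hP m hh⟩,
    fun m h N g hh => ?_, fun m h N g U hh hU => ⟨fun k hk => hU.eulerMatrix_mulVec_eq hP hh hk,
      fun k hk => hU.norm_le hd hP hh hk⟩, fun T α g u hT _ hu hD hholder => ?_⟩
  · simpa using norm_eulerMatrix_inv_pow_le hd hP m hh 1
  · obtain ⟨U, hU⟩ := exists_isImplicitEuler hd hP m N g hh
    exact ⟨U, hU, fun U' hU' k hk X hX => hU.eq hd hh hU' hk hX⟩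
  obtain ⟨u', u'', M, hD⟩ := hD
  have hu' := fun X hX t ht => (hD X hX t ht).1
  have hu'' := fun X hX t ht => (hD X hX t ht).2.1
  have hM := fun X hX t ht => (hD X hX t ht).2.2
  have hM0 : 0 ≤ M := (abs_nonneg _).trans
    (hM _ (vertex_mem_simplex P ⟨0, hd⟩) 0 (Set.left_mem_Icc.2 hT.le))
  set C : ℝ := √d * (T * ((d + 2) * M)) with hC
  have hbound : ∀ (m N : ℕ) (U : ℕ → Space d → ℝ), 1 ≤ N → IsImplicitEuler P m (T / N) N g U →
      normTwoInfty P m N (fun k X => u (k * (T / N)) X - U k X) ≤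
        C * (T / N + ((d : ℝ) / (d + 2)) ^ m) := by
    intro m N U hN hU
    refine (normTwoInfty_le hd (by positivity) fun k hk X hX =>
      hu.abs_error_le hT hd hP hu' hu'' hM hN hU hk hX).trans_eq ?_
    rw [hC]
    ring
  refine ⟨⟨C, fun m N U hN hU => ?_⟩, fun U hU => ?_⟩
  · rw [← inv_two_rpow_pow]
    -- If the rate asked for is faster than `r ^ m`, rigidity makes the error zero; otherwise
    -- `hbound` is enough.
    rcases lt_or_ge ((2⁻¹ : ℝ) ^ α) (d / (d + 2)) with hlt | hge
    · refine (normTwoInfty_le hd le_rfl fun k hk X hX => ?_).trans ?_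
      · rw [hu.error_eq_zero hT hd hP hu' hholder hlt hN hU hk hX, abs_zero]
      · rw [mul_zero]
        positivity
    · refine (hbound m N U hN hU).trans ?_
      gcongr
  -- Convergence uses the rate `r ^ m`, since `2 ^ (-(m * α))` does not tend to zero when `α = 0`.
  · have hr : (d : ℝ) / (d + 2) < 1 := by
      rw [div_lt_one (by positivity)]
      linarith
    have h1 : Filter.Tendsto (fun p : ℕ × ℕ => T / (p.2 : ℝ)) (Filter.atTop ×ˢ Filter.atTop)
        (nhds 0) := (tendsto_const_div_atTop_nhds_zero_nat T).comp Filter.tendsto_snd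
    have h2 : Filter.Tendsto (fun p : ℕ × ℕ => ((d : ℝ) / (d + 2)) ^ p.1)
        (Filter.atTop ×ˢ Filter.atTop) (nhds 0) :=
      (tendsto_pow_atTop_nhds_zero_of_lt_one (by positivity) hr).comp Filter.tendsto_fst
    have h3 := (h1.add h2).const_mul C
    rw [add_zero, mul_zero] at h3
    refine squeeze_zero' (Filter.Eventually.of_forall fun p => normTwoInfty_nonneg P _ _ _) ?_ h3
    filter_upwards [Filter.tendsto_snd.eventually (Filter.eventually_ge_atTop 1)] with p hp
    exact hbound p.1 p.2 (U p.1 p.2) hp (hU p.1 p.2 hp)
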